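/- Let $(\Sigma,\mu)$ be a $\sigma$-finite measure space, and write $L^q=L^q(\Sigma,\mu)$ (real-valued functions), $\|\cdot\|_q$ for its norm. An operator on $L^1$ is a subset $A\subseteq L^1\times L^1$, with domain $D(A)=\{u:\exists v,\ (u,v)\in A\}$ and resolvents $J_\lambda=(I+\lambda A)^{-1}$, $\lambda>0$. It is *$m$-$T$-accretive in $L^1$* if $\|[J_\lambda w-J_\lambda \hat w]^+\|_1\le\|[w-\hat w]^+\|_1$ for all $\lambda>0$ and $w,\hat w\in Rg(I+\lambda A)$, and $Rg(I+\lambda A)=L^1$ for some $\lambda>0$. It has *$c$-complete resolvent* if $\int_\Sigma j(J_\lambda w)\,d\mu\le\int_\Sigma j(w)\,d\mu$ for all $\lambda>0$, $w\in Rg(I+\lambda A)$ and all convex lower semicontinuous $j:\mathbb R\to[0,\infty]$, and *complete resolvent* if this holds for all such $j$ with $j(0)=0$. For $1\le q<\infty$ and $u,v\in L^q$ put $$[u,v]_q=\lim_{\lambda\to0+}\frac{\frac1q\|u+\lambda v\|_q^q-\frac1q\|u\|_q^q}{\lambda}=\inf_{\lambda>0}\frac{\frac1q\|u+\lambda v\|_q^q-\frac1q\|u\|_q^q}{\lambda}.$$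 The semigroup $\{T_t\}_{t\ge0}$ generated by $-A$ on $\overline{D(A)}^{L^1}$ is given by $T_tu=x(t)$, where $x\in C([0,\infty);L^1)$ is the mild solution of $\frac{dx}{dt}+Ax\ni0$, $x(0)=u$, that is, the uniform limit on compact time intervals of solutions of the implicit Euler scheme starting from $u$, along partitions with mesh tending to $0$. **Theorem.** Let $\omega\ge0$ and let $A$ be an operator on $L^1$ such that $A+\omega I$ is $m$-$T$-accretive in $L^1$ and has complete resolvent (respectively, has $c$-complete resolvent and $\omega=0$). Suppose the trace $A_{1\cap\infty}=A\cap\big((L^1\cap L^\infty)\times(L^1\cap L^\infty)\big)$ satisfies the range condition $$L^1\cap L^\infty\subseteq Rg\big(I+(A_{1\cap\infty}+\omega I)\big)$$ and, for some $1\le q<\infty$, $1\le r\le\infty$, $\sigma>0$, $\varrho\ge0$, $C>0$ and some $(u_0,0)\in A_{1\cap\infty}$, where $u_0=0$ if $\omega>0$, the Gagliardo–Nirenberg type inequality $$\|u-u_0\|_r^\sigma\le C\big([u-u_0,v]_q+\omega\|u-u_0\|_q^q\big)\,\|u-u_0\|_q^\varrho\qquad\text{for all }(u,v)\in A_{1\cap\infty}.$$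 Then the semigroup $\{T_t\}_{t\ge0}$ generated by $-A$ on $\overline{D(A)}^{L^1}$ satisfies $$\|T_tu-u_0\|_r\le\Big(\frac Cq\Big)^{1/\sigma}t^{-\alpha}e^{\omega\beta t}\|u-u_0\|_q^\gamma\qquad\text{for all }t>0,\ u\in\overline{D(A)}^{L^1}\cap L^\infty,$$ with $\alpha=\frac1\sigma$, $\gamma=\frac{q+\varrho}\sigma$ and $\beta=\gamma+1$. Moreover, let $\kappa>1$, $m>0$ and $q_0\ge p\ge1$ satisfy $\kappa mq_0\ge1$ and $(\kappa-1)q_0+p-1-\frac1m>0$, and suppose there is a constant $C'>0$ such that $$\|u-u_0\|_{\kappa m\tilde q}^{m\tilde q}\le\frac{C'(\tilde q/p)^p}{\tilde q-p+1}\Big([u-u_0,v]_{(\tilde q-p+1)m+1}+\omega\|u-u_0\|_{(\tilde q-p+1)m+1}^{(\tilde q-p+1)m+1}\Big)$$ for every $(u,v)\in A_{1\cap\infty}$ and every $\tilde q\ge q_0$. Put $$\alpha^*=\frac1{m((\kappa-1)q_0+p-1-\frac1m)},\qquad\gamma^*=\frac{(\kappa-1)q_0}{(\kappa-1)q_0+p-1-\frac1m}.$$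 Then there is a $\beta^*\ge0$ such that for every $1\le s\le\kappa mq_0$ with $\gamma^*\big(1-\frac s{\kappa mq_0}\big)<1$ there is a constant $K>0$ with $$\|T_tu-u_0\|_\infty\le K\,t^{-\alpha_s}e^{\omega\beta_st}\|u-u_0\|_s^{\gamma_s}\qquad\text{for all }t>0,\ u\in\overline{D(A)}^{L^1}\cap L^\infty,$$ where $$\alpha_s=\frac{\alpha^*}{1-\gamma^*(1-\frac s{\kappa mq_0})},\quad\beta_s=\frac{\frac{\beta^*}2+\frac{\gamma^*s}{\kappa mq_0}}{1-\gamma^*(1-\frac s{\kappa mq_0})},\quad\gamma_s=\frac{\gamma^*s}{\kappa mq_0\,\big(1-\gamma^*(1-\frac s{\kappa mq_0})\big)}.$$ -/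

import Mathlib

open MeasureTheory Set Filter Topology
open scoped ENNReal NNReal

/-! ### Multivalued operators, identified with their graphs -/

section Operators

variable {X : Type*} [NormedAddCommGroup X] [NormedSpace ℝ X]

/-- The effective domain `D(A)` of an operator `A ⊆ X × X`. -/
def opDomain (A : Set (X × X)) : Set X := {u | ∃ v, (u, v) ∈ A}

/-- The range `Rg(A)` of an operator `A ⊆ X × X`. -/
def opRange (A : Set (X × X)) : Set X := {v | ∃ u, (u, v) ∈ A}

/-- The operator `A + ω I`. -/
def opAddSmulId (A : Set (X × X)) (ω : ℝ) : Set (X × X) :=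
  {z | ∃ v, (z.1, v) ∈ A ∧ z.2 = v + ω • z.1}

/-- The operator `I + lam A`. -/
def opIdAddSmul (lam : ℝ) (A : Set (X × X)) : Set (X × X) :=
  {z | ∃ v, (z.1, v) ∈ A ∧ z.2 = z.1 + lam • v}

/-- The graph of the resolvent `J_lam = (I + lam A)⁻¹`: the pairs `(w, u)` with
`w ∈ u + lam A u`. -/
def resolventGraph (lam : ℝ) (A : Set (X × X)) : Set (X × X) :=
  {z | (z.2, z.1) ∈ opIdAddSmul lam A}

/-- `u` is a mild solution of `du/dt + A u ∋ 0`, `u(0) = u₀`: it is continuous on `[0, ∞)`,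
`u(0) = u₀`, and for all `S, ε > 0` there are a partition `0 = t₀ < ⋯ < t_N = S` of mesh less
than `ε` and a solution `w₀ = u₀`, `wᵢ + (tᵢ - tᵢ₋₁) A wᵢ ∋ wᵢ₋₁` of the implicit Euler scheme on it
whose piecewise constant interpolation is `ε`-close to `u`, uniformly on `[0, S]`. -/
def IsMildSolution (A : Set (X × X)) (u₀ : X) (u : ℝ → X) : Prop :=
  ContinuousOn u (Ici 0) ∧ u 0 = u₀ ∧
    ∀ S : ℝ, 0 < S → ∀ ε : ℝ, 0 < ε →
      ∃ (N : ℕ) (t : ℕ → ℝ) (w : ℕ → X),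
        t 0 = 0 ∧ t N = S ∧ w 0 = u₀ ∧
        ∀ i < N,
          t i < t (i + 1) ∧ t (i + 1) - t i < ε ∧
          (w i, w (i + 1)) ∈ resolventGraph (t (i + 1) - t i) A ∧
          ∀ s ∈ Ioc (t i) (t (i + 1)), ‖u s - w (i + 1)‖ ≤ ε

/-- `T` is the semigroup generated by `-A` on the closure of `D(A)`: for every `u` in the closure
of `D(A)`, the curve `t ↦ T t u` is the mild solution starting from `u`.
Only the values `T t u` with `0 ≤ t` and `u` in the closure of `D(A)` matter. -/
def IsSemigroupGeneratedByNeg (A : Set (X × X)) (T : ℝ → X → X) : Prop :=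
  ∀ u ∈ closure (opDomain A), IsMildSolution A u (fun t => T t u)

end Operators

/-! ### Operators in `L¹` -/

section LOne

variable {α : Type*} [MeasurableSpace α] {μ : Measure α}

/-- `S` is a `T`-contraction in `L¹`: `‖[S w - S w']⁺‖₁ ≤ ‖[w - w']⁺‖₁`. -/
def IsTContraction (S : Set (Lp ℝ 1 μ × Lp ℝ 1 μ)) : Prop :=
  ∀ z ∈ S, ∀ z' ∈ S, ‖(z.2 - z'.2)⁺‖ ≤ ‖(z.1 - z'.1)⁺‖

/-- `A` is `T`-accretive in `L¹`: all its resolvents are `T`-contractions. -/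
def IsTAccretive (A : Set (Lp ℝ 1 μ × Lp ℝ 1 μ)) : Prop :=
  ∀ lam : ℝ, 0 < lam → IsTContraction (resolventGraph lam A)

/-- `A` is `m`-`T`-accretive in `L¹`: it is `T`-accretive and `Rg(I + lam A) = L¹` for some
`lam > 0`. -/
def IsMTAccretive (A : Set (Lp ℝ 1 μ × Lp ℝ 1 μ)) : Prop :=
  IsTAccretive A ∧ ∃ lam : ℝ, 0 < lam ∧ opRange (opIdAddSmul lam A) = univ

/-- The class `𝒥` of convex, lower semicontinuous functions `j : ℝ → [0, ∞]`. -/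
def classJ : Set (ℝ → ℝ≥0∞) :=
  {j | ConvexOn ℝ≥0 univ j ∧ LowerSemicontinuous j}

/-- The class `𝒥₀` of those `j ∈ 𝒥` with `j(0) = 0`. -/
def classJ₀ : Set (ℝ → ℝ≥0∞) := {j | j ∈ classJ ∧ j 0 = 0}

/-- `S` is complete: `∫ j(S w) ≤ ∫ j(w)` for all `j ∈ 𝒥₀` and `w ∈ D(S)`. -/
def IsCompleteMap (S : Set (Lp ℝ 1 μ × Lp ℝ 1 μ)) : Prop :=
  ∀ j ∈ classJ₀, ∀ z ∈ S, ∫⁻ x, j (z.2 x) ∂μ ≤ ∫⁻ x, j (z.1 x) ∂μ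

/-- `S` is `c`-complete: `∫ j(S w) ≤ ∫ j(w)` for all `j ∈ 𝒥` and `w ∈ D(S)`. -/
def IsCCompleteMap (S : Set (Lp ℝ 1 μ × Lp ℝ 1 μ)) : Prop :=
  ∀ j ∈ classJ, ∀ z ∈ S, ∫⁻ x, j (z.2 x) ∂μ ≤ ∫⁻ x, j (z.1 x) ∂μ

/-- All resolvents of `A` are complete. -/
def HasCompleteResolvent (A : Set (Lp ℝ 1 μ × Lp ℝ 1 μ)) : Prop :=
  ∀ lam : ℝ, 0 < lam → IsCompleteMap (resolventGraph lam A)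

/-- All resolvents of `A` are `c`-complete. -/
def HasCCompleteResolvent (A : Set (Lp ℝ 1 μ × Lp ℝ 1 μ)) : Prop :=
  ∀ lam : ℝ, 0 < lam → IsCCompleteMap (resolventGraph lam A)

/-- `L¹ ∩ L^∞`, as a subset of `L¹`. -/
def LOneInter (μ : Measure α) : Set (Lp ℝ 1 μ) := {u | MemLp u ∞ μ}

/-- The trace `A_{1∩∞} = A ∩ ((L¹ ∩ L^∞) × (L¹ ∩ L^∞))`. -/
def opTrace (A : Set (Lp ℝ 1 μ × Lp ℝ 1 μ)) : Set (Lp ℝ 1 μ × Lp ℝ 1 μ) :=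
  A ∩ (LOneInter μ ×ˢ LOneInter μ)

/-- The norm `‖u‖_r`, `1 ≤ r ≤ ∞`, as a real number; used only for `u ∈ L¹ ∩ L^∞`. -/
noncomputable def rNorm (r : ℝ≥0∞) (u : Lp ℝ 1 μ) : ℝ := (eLpNorm u r μ).toReal

/-- The norm `‖u‖_q` for a real exponent `1 ≤ q < ∞`; used only for `u ∈ L¹ ∩ L^∞`. -/
noncomputable def qNorm (q : ℝ) (u : Lp ℝ 1 μ) : ℝ := rNorm (ENNReal.ofReal q) u

/-- The `q`-bracket `[u, v]_q`, the right-hand directional derivative at `u` in direction `v` of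
the convex function `(1/q) ‖·‖_q^q`, written as the infimum of the difference quotients; used only
for `u, v ∈ L¹ ∩ L^∞`, where these are bounded below. -/
noncomputable def qBracket (q : ℝ) (u v : Lp ℝ 1 μ) : ℝ :=
  ⨅ lam : Ioi (0 : ℝ),
    (1 / q * qNorm q (u + (lam : ℝ) • v) ^ q - 1 / q * qNorm q u ^ q) / (lam : ℝ)

/-- The Gagliardo-Nirenberg type inequality of a (trace) operator `B` with constant `C`:
`‖u - u₀‖_r^σ ≤ C ([u - u₀, v]_q + ω ‖u - u₀‖_q^q) ‖u - u₀‖_q^ϱ` for all `(u, v) ∈ B`. -/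
def SatisfiesGN (B : Set (Lp ℝ 1 μ × Lp ℝ 1 μ)) (u₀ : Lp ℝ 1 μ) (q : ℝ) (r : ℝ≥0∞)
    (σ ϱ ω C : ℝ) : Prop :=
  ∀ u v : Lp ℝ 1 μ, (u, v) ∈ B →
    rNorm r (u - u₀) ^ σ ≤
      C * (qBracket q (u - u₀) v + ω * qNorm q (u - u₀) ^ q) * qNorm q (u - u₀) ^ ϱ

/-- The one-parameter family of Sobolev type inequalities of a (trace) operator `B`, with a
constant `C` that does not depend on the parameter `q ≥ q₀`. -/
def SatisfiesSobolevFamily (B : Set (Lp ℝ 1 μ × Lp ℝ 1 μ)) (u₀ : Lp ℝ 1 μ)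
    (κ m p q₀ ω C : ℝ) : Prop :=
  ∀ q : ℝ, q₀ ≤ q → ∀ u v : Lp ℝ 1 μ, (u, v) ∈ B →
    qNorm (κ * m * q) (u - u₀) ^ (m * q) ≤
      C * (q / p) ^ p / (q - p + 1) *
        (qBracket ((q - p + 1) * m + 1) (u - u₀) v +
          ω * qNorm ((q - p + 1) * m + 1) (u - u₀) ^ ((q - p + 1) * m + 1))

end LOne

/-! ### Norms on L¹ ∩ L^∞ and the q-bracket -/

section Norms

variable {α : Type*} [MeasurableSpace α] {μ : Measure α}

/-! The equilibrium u₀ is in fact 0: completeness forces J₁0 = 0, so (0,0) lies in the trace, and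
the Gagliardo-Nirenberg inequality at (0,0) then annihilates u₀ (`SatisfiesGN.eq_zero`).

Completeness makes the resolvents of A + ωI contractive in every L^r, 1 ≤ r ≤ ∞, and an implicit
Euler step of A is such a resolvent applied to a rescaled datum. Hence along the scheme all norms
grow at most like e^{Ωt}, with Ω close to ω. In a step w = u + hv the choice λ = h in the infimum
gives [u,v]_q ≤ (‖w‖_q^q - ‖u‖_q^q)/(qh), so the Gagliardo-Nirenberg inequality bounds h‖u‖_r^σ by
an almost telescoping quantity. Summing, and using the almost monotonicity of the r-norm, gives
`discrete_smoothing`. Fatou's lemma on the left and L¹-L^∞ interpolation on the right carry this to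
mild solutions between any two times s < t (`IsMildSolution.smoothing`); no semigroup law is needed.

For the L^∞ bound, each member of the Sobolev family is such an inequality with ϱ = 0. Chaining the
resulting smoothing estimates along exponents that grow like κ^n and times that increase to t (Moser
iteration, `exists_moser_bound`) yields L^{κmq₀}-L^∞ smoothing. The passage to L^s interpolates
L^{κmq₀} between L^s and L^∞ on [τ/2, τ] and absorbs the L^∞ norm, which appears with a power less
than 1 (`le_of_le_mul_half_rpow`). -/

lemma eLpNorm_ofReal_eq {f : α → ℝ} {r : ℝ} (hr : 1 ≤ r) :
    eLpNorm f (ENNReal.ofReal r) μ = (∫⁻ x, ‖f x‖ₑ ^ r ∂μ) ^ (1 / r) := by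
  have h0 : ENNReal.ofReal r ≠ 0 := by
    rw [Ne, ENNReal.ofReal_eq_zero]; linarith
  rw [eLpNorm_eq_lintegral_rpow_enorm_toReal h0 ENNReal.ofReal_ne_top,
    ENNReal.toReal_ofReal (by linarith)]

lemma eLpNorm_interpolate {f : α → ℝ} (hM : eLpNorm f ∞ μ ≠ ∞) {s r : ℝ} (hs : 1 ≤ s) (hsr : s ≤ r) :
    eLpNorm f (ENNReal.ofReal r) μ ≤
      eLpNorm f ∞ μ ^ (1 - s / r) * eLpNorm f (ENNReal.ofReal s) μ ^ (s / r) := by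
  have hr : 1 ≤ r := hs.trans hsr
  have hr0 : 0 < r := by linarith
  have hs0 : 0 < s := by linarith
  rw [eLpNorm_ofReal_eq hr, eLpNorm_ofReal_eq hs, ← ENNReal.rpow_mul]
  have h1 : ∫⁻ x, ‖f x‖ₑ ^ r ∂μ ≤ eLpNorm f ∞ μ ^ (r - s) * ∫⁻ x, ‖f x‖ₑ ^ s ∂μ := by
    rcases eq_or_lt_of_le hsr with rfl | hlt
    · simp
    rw [← lintegral_const_mul' _ _ (ENNReal.rpow_ne_top_of_nonneg (by linarith) hM)]
    refine lintegral_mono_ae ?_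
    filter_upwards [ae_le_eLpNormEssSup (f := f) (μ := μ)] with x hx
    calc ‖f x‖ₑ ^ r = ‖f x‖ₑ ^ (r - s) * ‖f x‖ₑ ^ s := by
          rw [← ENNReal.rpow_add_of_nonneg _ _ (by linarith) hs0.le]; congr 1; ring
      _ ≤ _ := by
        rw [eLpNorm_exponent_top]
        gcongr
  calc (∫⁻ x, ‖f x‖ₑ ^ r ∂μ) ^ (1 / r)
      ≤ (eLpNorm f ∞ μ ^ (r - s) * ∫⁻ x, ‖f x‖ₑ ^ s ∂μ) ^ (1 / r) := by gcongr
    _ = _ := by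
      rw [ENNReal.mul_rpow_of_nonneg _ _ (by positivity), ← ENNReal.rpow_mul]
      congr 2 <;> field_simp

lemma memLp_of_mem_LOneInter {u : Lp ℝ 1 μ} (hu : u ∈ LOneInter μ) {r : ℝ≥0∞} (hr : 1 ≤ r) :
    MemLp u r μ := by
  by_cases h : r = ∞
  · rw [h]; exact hu
  have hr' : 1 ≤ r.toReal := by
    simpa using ENNReal.toReal_mono h hr
  refine ⟨Lp.aestronglyMeasurable u, ?_⟩
  rw [← ENNReal.ofReal_toReal h]
  refine (eLpNorm_interpolate hu.2.ne le_rfl hr').trans_lt ?_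
  refine ENNReal.mul_lt_top ?_ ?_
  · refine ENNReal.rpow_lt_top_of_nonneg ?_ hu.2.ne
    have := div_le_one_of_le₀ hr' (by linarith)
    linarith
  · refine ENNReal.rpow_lt_top_of_nonneg (by positivity) ?_
    rw [ENNReal.ofReal_one]
    exact (Lp.memLp u).2.ne

lemma one_le_ofReal {q : ℝ} (hq : 1 ≤ q) : 1 ≤ ENNReal.ofReal q := by
  simpa using ENNReal.ofReal_le_ofReal hq

lemma rNorm_nonneg (r : ℝ≥0∞) (u : Lp ℝ 1 μ) : 0 ≤ rNorm r u := ENNReal.toReal_nonneg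

lemma qNorm_nonneg (q : ℝ) (u : Lp ℝ 1 μ) : 0 ≤ qNorm q u := rNorm_nonneg _ u

lemma ofReal_rNorm {u : Lp ℝ 1 μ} (hu : u ∈ LOneInter μ) {r : ℝ≥0∞} (hr : 1 ≤ r) :
    ENNReal.ofReal (rNorm r u) = eLpNorm u r μ :=
  ENNReal.ofReal_toReal (memLp_of_mem_LOneInter hu hr).2.ne

lemma LOneInter_add {u v : Lp ℝ 1 μ} (hu : u ∈ LOneInter μ) (hv : v ∈ LOneInter μ) :
    u + v ∈ LOneInter μ :=
  (memLp_congr_ae (Lp.coeFn_add u v)).2 (MemLp.add hu hv)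

lemma LOneInter_smul {u : Lp ℝ 1 μ} (hu : u ∈ LOneInter μ) (c : ℝ) :
    c • u ∈ LOneInter μ :=
  (memLp_congr_ae (Lp.coeFn_smul c u)).2 (MemLp.const_smul hu c)

lemma LOneInter_sub {u v : Lp ℝ 1 μ} (hu : u ∈ LOneInter μ) (hv : v ∈ LOneInter μ) :
    u - v ∈ LOneInter μ :=
  (memLp_congr_ae (Lp.coeFn_sub u v)).2 (MemLp.sub hu hv)

lemma LOneInter_zero : (0 : Lp ℝ 1 μ) ∈ LOneInter μ :=
  (memLp_congr_ae (Lp.coeFn_zero ℝ 1 μ)).2 MemLp.zero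

lemma rNorm_add_le {u v : Lp ℝ 1 μ} (hu : u ∈ LOneInter μ) (hv : v ∈ LOneInter μ)
    {r : ℝ≥0∞} (hr : 1 ≤ r) : rNorm r (u + v) ≤ rNorm r u + rNorm r v := by
  have h1 := memLp_of_mem_LOneInter hu hr
  have h2 := memLp_of_mem_LOneInter hv hr
  unfold rNorm
  rw [← ENNReal.toReal_add h1.2.ne h2.2.ne, eLpNorm_congr_ae (Lp.coeFn_add u v)]
  exact ENNReal.toReal_mono (ENNReal.add_lt_top.2 ⟨h1.2, h2.2⟩).ne (eLpNorm_add_le h1.1 h2.1 hr)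

lemma rNorm_smul (r : ℝ≥0∞) (c : ℝ) (u : Lp ℝ 1 μ) : rNorm r (c • u) = |c| * rNorm r u := by
  unfold rNorm
  rw [eLpNorm_congr_ae (Lp.coeFn_smul c u), eLpNorm_const_smul, ENNReal.toReal_mul]
  simp

lemma rNorm_neg (r : ℝ≥0∞) (u : Lp ℝ 1 μ) : rNorm r (-u) = rNorm r u := by
  have := rNorm_smul r (-1) u
  simpa using this

lemma eq_zero_of_rNorm_eq_zero {u : Lp ℝ 1 μ} (hu : u ∈ LOneInter μ) {r : ℝ≥0∞} (hr : 1 ≤ r)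
    (h : rNorm r u = 0) : u = 0 := by
  have h1 := ofReal_rNorm hu hr
  rw [h, ENNReal.ofReal_zero] at h1
  have h2 := (eLpNorm_eq_zero_iff (Lp.aestronglyMeasurable u)
    (by intro h0; simp [h0] at hr)).1 h1.symm
  exact (Lp.eq_zero_iff_ae_eq_zero).2 h2

lemma qNorm_interpolate {u : Lp ℝ 1 μ} (hu : u ∈ LOneInter μ) {s r : ℝ} (hs : 1 ≤ s)
    (hsr : s ≤ r) : qNorm r u ≤ rNorm ∞ u ^ (1 - s / r) * qNorm s u ^ (s / r) := by
  have hsr1 : s / r ≤ 1 := div_le_one_of_le₀ hsr (by linarith)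
  have hsr0 : 0 ≤ s / r := div_nonneg (by linarith) (by linarith)
  have h := ENNReal.toReal_mono ?_ (eLpNorm_interpolate hu.2.ne hs hsr)
  · rwa [ENNReal.toReal_mul, ← ENNReal.toReal_rpow, ← ENNReal.toReal_rpow] at h
  · exact (ENNReal.mul_lt_top (ENNReal.rpow_lt_top_of_nonneg (by linarith) hu.2.ne)
      (ENNReal.rpow_lt_top_of_nonneg hsr0
        (memLp_of_mem_LOneInter hu (one_le_ofReal hs)).2.ne)).ne

/-- By convexity every difference quotient with λ > 0 dominates the one at λ = -1, since u is a
convex combination of u - v and u + λv. Without a lower bound the real infimum would take the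
default value 0 and `qBracket_le` could fail. -/
lemma bddBelow_qBracket {u v : Lp ℝ 1 μ} (hu : u ∈ LOneInter μ) (hv : v ∈ LOneInter μ) {q : ℝ}
    (hq : 1 ≤ q) : BddBelow (range fun lam : Ioi (0 : ℝ) =>
      (1 / q * qNorm q (u + (lam : ℝ) • v) ^ q - 1 / q * qNorm q u ^ q) / (lam : ℝ)) := by
  refine ⟨1 / q * qNorm q u ^ q - 1 / q * qNorm q (u - v) ^ q, ?_⟩
  rintro _ ⟨⟨l, hl⟩, rfl⟩
  simp only [mem_Ioi] at hl ⊢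
  have hl1 : 0 < 1 + l := by linarith
  have hq1 := one_le_ofReal hq
  have h1 : qNorm q u ≤ l / (1 + l) * qNorm q (u - v) + 1 / (1 + l) * qNorm q (u + l • v) := by
    have : u = (l / (1 + l)) • (u - v) + (1 / (1 + l)) • (u + l • v) := by
      have e : l / (1 + l) + 1 / (1 + l) = 1 := by field_simp; ring
      have e2 : (1 / (1 + l)) * l = l / (1 + l) := by ring
      rw [smul_sub, smul_add, smul_smul, e2]
      calc u = (l / (1 + l) + 1 / (1 + l)) • u := by rw [e, one_smul]
        _ = _ := by rw [add_smul]; abel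
    have h2 := rNorm_add_le (LOneInter_smul (LOneInter_sub hu hv) (l / (1 + l)))
      (LOneInter_smul (LOneInter_add hu (LOneInter_smul hv l)) (1 / (1 + l))) hq1
    rw [← this, rNorm_smul, rNorm_smul, abs_of_pos (by positivity),
      abs_of_pos (by positivity)] at h2
    exact h2
  have h3 := (convexOn_rpow hq).2 (mem_Ici.2 (qNorm_nonneg q (u - v)))
    (mem_Ici.2 (qNorm_nonneg q (u + l • v))) (by positivity : 0 ≤ l / (1 + l))
    (by positivity : 0 ≤ 1 / (1 + l)) (by field_simp; ring)
  simp only [smul_eq_mul] at h3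
  have h4 := (Real.rpow_le_rpow (qNorm_nonneg q u) h1 (by linarith)).trans h3
  have h5 : (1 + l) * qNorm q u ^ q ≤ l * qNorm q (u - v) ^ q + qNorm q (u + l • v) ^ q := by
    have := mul_le_mul_of_nonneg_left h4 hl1.le
    refine this.trans (le_of_eq ?_)
    field_simp
  rw [le_div_iff₀ hl]
  have h6 := mul_le_mul_of_nonneg_left h5 (by positivity : 0 ≤ 1 / q)
  linarith

lemma qBracket_le {u v : Lp ℝ 1 μ} (hu : u ∈ LOneInter μ) (hv : v ∈ LOneInter μ) {q : ℝ}
    (hq : 1 ≤ q) {l : ℝ} (hl : 0 < l) :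
    qBracket q u v ≤ (1 / q * qNorm q (u + l • v) ^ q - 1 / q * qNorm q u ^ q) / l :=
  ciInf_le (bddBelow_qBracket hu hv hq) (⟨l, hl⟩ : Ioi (0 : ℝ))

end Norms

/-! ### Contractivity of complete maps, and limits of norms -/

section Contraction

variable {α : Type*} [MeasurableSpace α] {μ : Measure α}

lemma ofReal_comp_mem_classJ₀ {g : ℝ → ℝ} (hg : ConvexOn ℝ univ g) (hc : Continuous g)
    (h0 : g 0 ≤ 0) : (fun s => ENNReal.ofReal (g s)) ∈ classJ₀ := by
  refine ⟨⟨⟨convex_univ, ?_⟩, (ENNReal.continuous_ofReal.comp hc).lowerSemicontinuous⟩,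
    ENNReal.ofReal_eq_zero.2 h0⟩
  intro x _ y _ a b _ _ hab
  have hab' : (a : ℝ) + b = 1 := by exact_mod_cast hab
  have h := hg.2 (mem_univ x) (mem_univ y) a.2 b.2 hab'
  simp only [smul_eq_mul] at h
  calc ENNReal.ofReal (g (a • x + b • y))
      ≤ ENNReal.ofReal (a * g x + b * g y) := ENNReal.ofReal_le_ofReal h
    _ ≤ ENNReal.ofReal (a * g x) + ENNReal.ofReal (b * g y) := ENNReal.ofReal_add_le
    _ = _ := by
      rw [ENNReal.ofReal_mul a.coe_nonneg, ENNReal.ofReal_mul b.coe_nonneg, ENNReal.smul_def, ENNReal.smul_def,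
        smul_eq_mul, smul_eq_mul, ENNReal.ofReal_coe_nnreal, ENNReal.ofReal_coe_nnreal]

/-- For finite r the integrand is |s|^r. For r = ∞ it is (|s| - M)⁺ with M the sup norm of the
datum: its integral vanishes on the datum, hence on the image. -/
lemma IsCompleteMap.eLpNorm_le {S : Set (Lp ℝ 1 μ × Lp ℝ 1 μ)} (hS : IsCompleteMap S)
    {z : Lp ℝ 1 μ × Lp ℝ 1 μ} (hz : z ∈ S) {r : ℝ≥0∞} (hr : 1 ≤ r) :
    eLpNorm z.2 r μ ≤ eLpNorm z.1 r μ := by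
  by_cases hr' : r = ∞
  · subst hr'
    by_cases hM : eLpNorm z.1 ∞ μ = ∞
    · rw [hM]; exact le_top
    set M := (eLpNorm z.1 ∞ μ).toReal with hMdef
    have hM' : ENNReal.ofReal M = eLpNorm z.1 ∞ μ := ENNReal.ofReal_toReal hM
    have hj : (fun s : ℝ => ENNReal.ofReal (|s| - M)) ∈ classJ₀ :=
      ofReal_comp_mem_classJ₀ ((convexOn_norm convex_univ).sub (concaveOn_const M convex_univ))
        (by fun_prop) (by simp [hMdef])
    have h := hS _ hj z hz
    have h1 : ∫⁻ x, ENNReal.ofReal (|z.1 x| - M) ∂μ = 0 := by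
      rw [lintegral_eq_zero_iff' (by have := (Lp.aestronglyMeasurable z.1).aemeasurable; fun_prop)]
      filter_upwards [ae_le_eLpNormEssSup (f := z.1) (μ := μ)] with x hx
      rw [← eLpNorm_exponent_top, ← hM', Real.enorm_eq_ofReal_abs,
        ENNReal.ofReal_le_ofReal_iff ENNReal.toReal_nonneg] at hx
      exact ENNReal.ofReal_eq_zero.2 (sub_nonpos.2 hx)
    rw [h1, nonpos_iff_eq_zero, lintegral_eq_zero_iff'
      (by have := (Lp.aestronglyMeasurable z.2).aemeasurable; fun_prop)] at h
    rw [← hM', eLpNorm_exponent_top]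
    refine eLpNormEssSup_le_of_ae_enorm_bound ?_
    filter_upwards [h] with x hx
    rw [Real.enorm_eq_ofReal_abs]
    refine ENNReal.ofReal_le_ofReal ?_
    simpa using hx
  · have hr1 : 1 ≤ r.toReal := by simpa using ENNReal.toReal_mono hr' hr
    rw [← ENNReal.ofReal_toReal hr', eLpNorm_ofReal_eq hr1, eLpNorm_ofReal_eq hr1]
    have hj : (fun s : ℝ => ENNReal.ofReal (|s| ^ r.toReal)) ∈ classJ₀ := by
      refine ofReal_comp_mem_classJ₀ ?_ ?_ ?_
      · refine ⟨convex_univ, fun x _ y _ a b ha hb hab => ?_⟩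
        have h1 := (convexOn_rpow hr1).2 (mem_Ici.2 (abs_nonneg x)) (mem_Ici.2 (abs_nonneg y))
          ha hb hab
        refine le_trans (Real.rpow_le_rpow (abs_nonneg _) ?_ (by linarith)) h1
        have := (convexOn_norm (E := ℝ) convex_univ).2 (mem_univ x) (mem_univ y) ha hb hab
        simpa using this
      · exact continuous_abs.rpow_const (fun _ => Or.inr (by linarith))
      · simp [Real.zero_rpow (by linarith : r.toReal ≠ 0)]
    have h := hS _ hj z hz
    have e : ∀ s : ℝ, ENNReal.ofReal (|s| ^ r.toReal) = ‖s‖ₑ ^ r.toReal := fun s => by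
      rw [Real.enorm_eq_ofReal_abs, ENNReal.ofReal_rpow_of_nonneg (abs_nonneg _) (by linarith)]
    simp only [e] at h
    gcongr

/-- Fatou's lemma along an a.e. convergent subsequence; r = ∞ is included, and finiteness of the
limit's norm is part of the conclusion. -/
lemma eLpNorm_le_of_tendsto {w : ℕ → Lp ℝ 1 μ} {x : Lp ℝ 1 μ} (hw : Tendsto w atTop (𝓝 x))
    {r : ℝ≥0∞} {B : ℕ → ℝ} {b : ℝ} (hB : Tendsto B atTop (𝓝 b))
    (h : ∀ᶠ n in atTop, eLpNorm (w n) r μ ≤ ENNReal.ofReal (B n)) :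
    eLpNorm x r μ ≤ ENNReal.ofReal b := by
  have h1 := tendstoInMeasure_of_tendsto_Lp hw
  obtain ⟨ns, hns, hae⟩ := h1.exists_seq_tendsto_ae
  refine (Lp.eLpNorm_lim_le_liminf_eLpNorm (fun n => Lp.aestronglyMeasurable (w (ns n))) x
    hae).trans ?_
  have hB' : Tendsto (fun n => ENNReal.ofReal (B (ns n))) atTop (𝓝 (ENNReal.ofReal b)) :=
    (ENNReal.continuous_ofReal.tendsto _).comp (hB.comp hns.tendsto_atTop)
  rw [← hB'.liminf_eq]
  exact liminf_le_liminf (hns.tendsto_atTop.eventually h)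

/-- A uniform L^∞ bound upgrades L¹ convergence to L^q convergence by interpolating the difference
between L¹ and L^∞. -/
lemma tendsto_qNorm {w : ℕ → Lp ℝ 1 μ} {x : Lp ℝ 1 μ} (hw : Tendsto w atTop (𝓝 x))
    (hx : x ∈ LOneInter μ) (hwi : ∀ n, w n ∈ LOneInter μ) {M : ℝ}
    (hM : ∀ n, rNorm ∞ (w n) ≤ M) {q : ℝ} (hq : 1 ≤ q) :
    Tendsto (fun n => qNorm q (w n)) atTop (𝓝 (qNorm q x)) := by
  have hq1 := one_le_ofReal hq
  have hq0 : 0 < q := by linarith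
  have h1 : Tendsto (fun n => (M + rNorm ∞ x) ^ (1 - 1 / q) * ‖w n - x‖ ^ (1 / q)) atTop
      (𝓝 0) := by
    have : Tendsto (fun n => ‖w n - x‖) atTop (𝓝 0) := tendsto_iff_norm_sub_tendsto_zero.1 hw
    have h2 := (this.rpow_const (p := 1 / q) (Or.inr (by positivity))).const_mul
      ((M + rNorm ∞ x) ^ (1 - 1 / q))
    rwa [Real.zero_rpow (by positivity), mul_zero] at h2
  rw [tendsto_iff_norm_sub_tendsto_zero]
  refine squeeze_zero (fun _ => norm_nonneg _) (fun n => ?_) h1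
  have hd := LOneInter_sub (hwi n) hx
  have h3 : qNorm q (w n - x) ≤ (M + rNorm ∞ x) ^ (1 - 1 / q) * ‖w n - x‖ ^ (1 / q) := by
    refine (qNorm_interpolate hd le_rfl hq).trans ?_
    have e : qNorm 1 (w n - x) = ‖w n - x‖ := by
      simp [qNorm, rNorm, Lp.norm_def]
    rw [e]
    refine mul_le_mul_of_nonneg_right (Real.rpow_le_rpow (rNorm_nonneg _ _) ?_ ?_) (by positivity)
    · have := rNorm_add_le (hwi n) (LOneInter_smul hx (-1)) (r := ∞) le_top
      rw [neg_one_smul, rNorm_neg, ← sub_eq_add_neg] at this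
      linarith [hM n]
    · have := div_le_one_of_le₀ hq hq0.le
      linarith
  refine le_trans ?_ h3
  rw [Real.norm_eq_abs, abs_le]
  have h4 := rNorm_add_le hd hx hq1
  have h5 := rNorm_add_le (LOneInter_smul hd (-1)) (hwi n) hq1
  rw [sub_add_cancel] at h4
  rw [neg_one_smul, rNorm_neg, neg_sub, sub_add_cancel] at h5
  unfold qNorm
  constructor <;> linarith

lemma rNorm_top_le_of_tendsto {u : Lp ℝ 1 μ} (hu : u ∈ LOneInter μ) {r B : ℕ → ℝ} {b : ℝ}
    (hr : Tendsto r atTop atTop) (hB : Tendsto B atTop (𝓝 b))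
    (h : ∀ᶠ n in atTop, qNorm (r n) u ≤ B n) : rNorm ∞ u ≤ b := by
  have hr1 : ∀ᶠ n in atTop, 1 ≤ r n := hr.eventually_ge_atTop 1
  have hb0 : 0 ≤ b := by
    refine ge_of_tendsto hB ?_
    filter_upwards [h] with n hn using (qNorm_nonneg _ _).trans hn
  refine le_of_forall_pos_le_add fun ε hε => ?_
  set c := b + ε with hc
  have hc0 : 0 < c := by linarith
  -- Eventually ‖u‖_{r_n} < d, so Chebyshev gives μ{|u| ≥ c} ≤ (d/c)^{r_n}, which tends to 0 because
  -- d < c. This needs no finiteness of μ.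
  obtain ⟨d, hd1, hd2⟩ := exists_between (show b < c by linarith)
  have hd0 : 0 ≤ d := by linarith
  have hmeas : μ {x | ENNReal.ofReal c ≤ ‖u x‖ₑ} = 0 := by
    have h1 : ∀ᶠ n in atTop, μ {x | ENNReal.ofReal c ≤ ‖u x‖ₑ} ≤
        ENNReal.ofReal ((d / c) ^ (r n)) := by
      filter_upwards [h, hr1, hB.eventually_lt_const hd1] with n hn hrn hBn
      have hrn' := one_le_ofReal hrn
      have h2 := mul_meas_ge_le_pow_eLpNorm' μ (p := ENNReal.ofReal (r n))
        (by intro h0; rw [h0] at hrn'; simp at hrn') ENNReal.ofReal_ne_top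
        (Lp.aestronglyMeasurable u) (ENNReal.ofReal c)
      rw [ENNReal.toReal_ofReal (by linarith), ← ofReal_rNorm hu hrn',
        ENNReal.ofReal_rpow_of_nonneg hc0.le (by linarith),
        ENNReal.ofReal_rpow_of_nonneg (rNorm_nonneg _ _) (by linarith)] at h2
      have hcp : 0 < c ^ r n := Real.rpow_pos_of_pos hc0 _
      have h3 : rNorm (ENNReal.ofReal (r n)) u ^ r n ≤ d ^ r n :=
        Real.rpow_le_rpow (rNorm_nonneg _ _) (hn.trans hBn.le) (by linarith)
      rw [Real.div_rpow hd0 hc0.le, ENNReal.ofReal_div_of_pos hcp,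
        ENNReal.le_div_iff_mul_le (Or.inl (by simpa using hcp)) (Or.inl ENNReal.ofReal_ne_top),
        mul_comm]
      exact h2.trans (ENNReal.ofReal_le_ofReal h3)
    have h2 : Tendsto (fun n => ENNReal.ofReal ((d / c) ^ (r n))) atTop (𝓝 0) := by
      have h3 : Tendsto (fun n => (d / c) ^ (r n)) atTop (𝓝 0) :=
        (tendsto_rpow_atTop_of_base_lt_one _ (by have : 0 ≤ d / c := by positivity
                                                 linarith) ((div_lt_one hc0).2 hd2)).comp hr
      simpa [Function.comp_def] using (ENNReal.continuous_ofReal.tendsto _).comp h3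
    exact le_antisymm (ge_of_tendsto h2 h1) zero_le
  refine ENNReal.toReal_le_of_le_ofReal hc0.le ?_
  rw [eLpNorm_exponent_top]
  refine eLpNormEssSup_le_of_ae_enorm_bound ?_
  have : ∀ᵐ x ∂μ, ¬ ENNReal.ofReal c ≤ ‖u x‖ₑ := by
    rw [ae_iff]; simpa using hmeas
  filter_upwards [this] with x hx using (not_le.1 hx).le

end Contraction

/-! ### Discrete growth and smoothing estimates for real sequences -/

section Discrete

/-- From 1/(1 - y) = 1 + y/(1 - y) ≤ e^{y/(1-y)} with y = ch. The slightly enlarged rate c/(1 - cε)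
serves all steps h ≤ ε at once. -/
lemma exp_neg_le_one_sub {c ε h : ℝ} (hc : 0 ≤ c) (hh : 0 ≤ h) (hε : h ≤ ε) (hcε : c * ε < 1) :
    Real.exp (-(c / (1 - c * ε) * h)) ≤ 1 - c * h := by
  have hx : c * h ≤ c * ε := mul_le_mul_of_nonneg_left hε hc
  have h1 : 0 < 1 - c * ε := by linarith
  have h2 : 0 < 1 - c * h := by linarith
  have h3 : c * h / (1 - c * h) ≤ c / (1 - c * ε) * h := by
    rw [div_mul_eq_mul_div]
    exact div_le_div_of_nonneg_left (mul_nonneg hc hh) h1 (by linarith)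
  have h4 := Real.add_one_le_exp (c / (1 - c * ε) * h)
  have h5 : 1 / (1 - c * h) ≤ Real.exp (c / (1 - c * ε) * h) := by
    refine le_trans (le_of_eq ?_) ((add_le_add_left h3 1).trans h4)
    field_simp
    ring
  rw [Real.exp_neg, inv_le_comm₀ (Real.exp_pos _) h2, ← one_div]
  exact h5

lemma le_exp_mul_of_step {t n : ℕ → ℝ} {Ω : ℝ} {M : ℕ}
    (hn : ∀ i < M, n (i + 1) ≤ Real.exp (Ω * (t (i + 1) - t i)) * n i) :
    ∀ i ≤ M, n i ≤ Real.exp (Ω * (t i - t 0)) * n 0 := by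
  intro i
  induction i with
  | zero => intro _; simp
  | succ i ih =>
    intro hi
    calc n (i + 1) ≤ Real.exp (Ω * (t (i + 1) - t i)) * n i := hn i (by omega)
      _ ≤ Real.exp (Ω * (t (i + 1) - t i)) * (Real.exp (Ω * (t i - t 0)) * n 0) := by
        gcongr
        exact ih (by omega)
      _ = _ := by rw [← mul_assoc, ← Real.exp_add]; ring_nf

/-- Here x and n stand for the r-norms and q-norms along the Euler scheme. The rate Ω replaces ω so
that the discounted quantities are exactly monotone. -/
lemma discrete_smoothing {t x n : ℕ → ℝ} {Ω ω q σ ϱ C : ℝ} {M : ℕ} (hΩ0 : 0 ≤ Ω)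
    (hq : 1 ≤ q) (hσ : 0 < σ) (hϱ : 0 ≤ ϱ) (hC : 0 < C)
    (hx0 : ∀ i, 0 ≤ x i) (hn0 : ∀ i, 0 ≤ n i) (ht : ∀ i < M, t i < t (i + 1))
    (hx : ∀ i < M, x (i + 1) ≤ Real.exp (Ω * (t (i + 1) - t i)) * x i)
    (hn : ∀ i < M, n (i + 1) ≤ Real.exp (Ω * (t (i + 1) - t i)) * n i)
    (hΩ : ∀ i < M, Real.exp (-(q * Ω * (t (i + 1) - t i))) ≤ 1 - q * ω * (t (i + 1) - t i))
    (hGN : ∀ i < M, x (i + 1) ^ σ ≤ C * ((1 / q * n i ^ q - 1 / q * n (i + 1) ^ q) /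
      (t (i + 1) - t i) + ω * n (i + 1) ^ q) * n (i + 1) ^ ϱ) :
    (t M - t 0) * x M ^ σ ≤
      C / q * Real.exp (Ω * (t M - t 0) * (σ + q + ϱ)) * n 0 ^ (q + ϱ) := by
  have hq0 : 0 < q := by linarith
  have htm : ∀ i ≤ M, ∀ j ≤ i, t j ≤ t i := by
    intro i
    induction i with
    | zero => intro _ j hj; rw [Nat.le_zero.1 hj]
    | succ i ih =>
      intro hi j hj
      rcases Nat.le_succ_iff.1 hj with h | h
      · exact (ih (by omega) j h).trans (ht i (by omega)).le
      · rw [h]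
  set L := t M - t 0 with hL
  have hL0 : 0 ≤ L := sub_nonneg.2 (htm M le_rfl 0 (Nat.zero_le _))
  have hnn := le_exp_mul_of_step hn
  -- Discounted q-th powers: nonincreasing, so their differences telescope with the right sign. The
  -- factor E pays for removing the discount and for bounding n (i + 1) ^ ϱ by n 0 ^ ϱ.
  set b : ℕ → ℝ := fun i => Real.exp (-(q * Ω * (t i - t 0))) * n i ^ q with hb
  set E := Real.exp (Ω * L * (q + ϱ)) with hE
  have hbstep : ∀ i < M, b (i + 1) ≤ b i := by
    intro i hi
    have h1 : n (i + 1) ^ q ≤ Real.exp (q * Ω * (t (i + 1) - t i)) * n i ^ q := by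
      refine (Real.rpow_le_rpow (hn0 _) (hn i hi) hq0.le).trans (le_of_eq ?_)
      rw [Real.mul_rpow (Real.exp_pos _).le (hn0 _), ← Real.exp_mul]
      ring_nf
    calc b (i + 1) ≤ Real.exp (-(q * Ω * (t (i + 1) - t 0))) *
          (Real.exp (q * Ω * (t (i + 1) - t i)) * n i ^ q) := by
          simp only [hb]; gcongr
      _ = b i := by simp only [hb]; rw [← mul_assoc, ← Real.exp_add]; ring_nf
  have hstep : ∀ i < M, (t (i + 1) - t i) * x (i + 1) ^ σ ≤
      C / q * E * n 0 ^ ϱ * (b i - b (i + 1)) := by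
    intro i hi
    have hh : 0 < t (i + 1) - t i := sub_pos.2 (ht i hi)
    have hnρ : n (i + 1) ^ ϱ ≤ Real.exp (Ω * L * ϱ) * n 0 ^ ϱ := by
      have h1 : n (i + 1) ≤ Real.exp (Ω * L) * n 0 := by
        refine (hnn (i + 1) hi).trans ?_
        have : t (i + 1) - t 0 ≤ L := by linarith [htm M le_rfl (i + 1) hi]
        have := hn0 0
        gcongr
      refine (Real.rpow_le_rpow (hn0 _) h1 hϱ).trans (le_of_eq ?_)
      rw [Real.mul_rpow (Real.exp_pos _).le (hn0 _), ← Real.exp_mul]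
    have hbb : n i ^ q - (1 - q * ω * (t (i + 1) - t i)) * n (i + 1) ^ q ≤
        Real.exp (Ω * L * q) * (b i - b (i + 1)) := by
      calc n i ^ q - (1 - q * ω * (t (i + 1) - t i)) * n (i + 1) ^ q
          ≤ n i ^ q - Real.exp (-(q * Ω * (t (i + 1) - t i))) * n (i + 1) ^ q := by
            have := mul_le_mul_of_nonneg_right (hΩ i hi)
              (Real.rpow_nonneg (hn0 (i + 1)) q)
            linarith
        _ = Real.exp (q * Ω * (t i - t 0)) * (b i - b (i + 1)) := by
            simp only [hb]
            rw [mul_sub (Real.exp _), ← mul_assoc, ← mul_assoc, ← Real.exp_add, ← Real.exp_add,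
              add_neg_cancel, Real.exp_zero, one_mul]
            ring_nf
        _ ≤ _ := by
            refine mul_le_mul_of_nonneg_right (Real.exp_le_exp.2 ?_)
              (sub_nonneg.2 (hbstep i hi))
            have : t i - t 0 ≤ L := by linarith [htm M le_rfl i hi.le]
            nlinarith [mul_le_mul_of_nonneg_left this (mul_nonneg hq0.le hΩ0)]
    calc (t (i + 1) - t i) * x (i + 1) ^ σ
        ≤ (t (i + 1) - t i) * (C * ((1 / q * n i ^ q - 1 / q * n (i + 1) ^ q) /
          (t (i + 1) - t i) + ω * n (i + 1) ^ q) * n (i + 1) ^ ϱ) := by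
          gcongr; exact hGN i hi
      _ = C / q * n (i + 1) ^ ϱ *
          (n i ^ q - (1 - q * ω * (t (i + 1) - t i)) * n (i + 1) ^ q) := by
          field_simp
          ring
      _ ≤ C / q * n (i + 1) ^ ϱ * (Real.exp (Ω * L * q) * (b i - b (i + 1))) := by
          have := Real.rpow_nonneg (hn0 (i + 1)) ϱ
          gcongr
      _ ≤ C / q * (Real.exp (Ω * L * ϱ) * n 0 ^ ϱ) *
          (Real.exp (Ω * L * q) * (b i - b (i + 1))) := by
          have := sub_nonneg.2 (hbstep i hi)
          gcongr
      _ = _ := by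
          rw [hE, mul_add (Ω * L), Real.exp_add]; ring
  -- With X_i the discounted x_i^σ, which is nonincreasing, (t_{i+1} - t₀)X_{i+1} ≤ (t_i - t₀)X_i +
  -- (t_{i+1} - t_i)x_{i+1}^σ, and `hstep` controls the last term.
  have key : ∀ i ≤ M, (t i - t 0) * (Real.exp (-(Ω * σ * (t i - t 0))) * x i ^ σ) ≤
      C / q * E * n 0 ^ ϱ * (b 0 - b i) := by
    intro i
    induction i with
    | zero => intro _; simp
    | succ i ih =>
      intro hi
      have hh : 0 < t (i + 1) - t i := sub_pos.2 (ht i hi)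
      have h0 : 0 ≤ t i - t 0 := sub_nonneg.2 (htm i (by omega) 0 (Nat.zero_le _))
      have h1 : x (i + 1) ^ σ ≤ Real.exp (Ω * σ * (t (i + 1) - t i)) * x i ^ σ := by
        refine (Real.rpow_le_rpow (hx0 _) (hx i hi) hσ.le).trans (le_of_eq ?_)
        rw [Real.mul_rpow (Real.exp_pos _).le (hx0 _), ← Real.exp_mul]
        ring_nf
      have h2 : Real.exp (-(Ω * σ * (t (i + 1) - t 0))) * x (i + 1) ^ σ ≤
          Real.exp (-(Ω * σ * (t i - t 0))) * x i ^ σ := by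
        calc _ ≤ Real.exp (-(Ω * σ * (t (i + 1) - t 0))) *
              (Real.exp (Ω * σ * (t (i + 1) - t i)) * x i ^ σ) := by gcongr
          _ = _ := by rw [← mul_assoc, ← Real.exp_add]; ring_nf
      have h3 : Real.exp (-(Ω * σ * (t (i + 1) - t 0))) * x (i + 1) ^ σ ≤ x (i + 1) ^ σ := by
        refine mul_le_of_le_one_left (Real.rpow_nonneg (hx0 _) _) ?_
        rw [Real.exp_le_one_iff]
        have : 0 ≤ t (i + 1) - t 0 := by linarith
        have := mul_nonneg (mul_nonneg hΩ0 hσ.le) this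
        linarith
      have h4 := mul_le_mul_of_nonneg_left h2 h0
      have h5 := mul_le_mul_of_nonneg_left h3 hh.le
      have h6 := ih (by omega)
      have h7 := hstep i hi
      linarith
  have hfin := key M le_rfl
  have hbM : 0 ≤ b M := mul_nonneg (Real.exp_pos _).le (Real.rpow_nonneg (hn0 _) _)
  have hb0 : b 0 = n 0 ^ q := by simp [hb]
  have hcoef : 0 ≤ C / q * E * n 0 ^ ϱ := by
    have := Real.rpow_nonneg (hn0 0) ϱ
    positivity
  have h8 : L * (Real.exp (-(Ω * σ * L)) * x M ^ σ) ≤ C / q * E * n 0 ^ ϱ * n 0 ^ q := by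
    refine hfin.trans (mul_le_mul_of_nonneg_left ?_ hcoef)
    rw [hb0]; linarith
  calc L * x M ^ σ = Real.exp (Ω * σ * L) * (L * (Real.exp (-(Ω * σ * L)) * x M ^ σ)) := by
        rw [Real.exp_neg]; field_simp
    _ ≤ Real.exp (Ω * σ * L) * (C / q * E * n 0 ^ ϱ * n 0 ^ q) := by gcongr
    _ = C / q * (Real.exp (Ω * σ * L) * E) * (n 0 ^ q * n 0 ^ ϱ) := by ring
    _ = _ := by
      rw [hE, ← Real.exp_add, Real.rpow_add_of_nonneg (hn0 0) hq0.le hϱ]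
      ring_nf

end Discrete

/-! ### The implicit Euler scheme -/

section Euler

variable {α : Type*} [MeasurableSpace α] {μ : Measure α}

/-- Rewrite w = u + hv as w = (1 - ωh)u + h(v + ωu) and divide by 1 - ωh. -/
lemma euler_step_mem {A : Set (Lp ℝ 1 μ × Lp ℝ 1 μ)} {ω h : ℝ} (hh : 0 < h) (hωh : ω * h < 1)
    {w u : Lp ℝ 1 μ} (hwu : (w, u) ∈ resolventGraph h A) :
    ((1 - ω * h)⁻¹ • w, u) ∈ resolventGraph (h / (1 - ω * h)) (opAddSmulId A ω) := by
  obtain ⟨v, hv, hw⟩ := hwu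
  simp only at hv hw
  refine ⟨v + ω • u, ⟨v, hv, rfl⟩, ?_⟩
  have h1 : 1 - ω * h ≠ 0 := by linarith
  have e : (1 - ω * h)⁻¹ = 1 + h / (1 - ω * h) * ω := by field_simp; ring
  have e2 : (1 - ω * h)⁻¹ * h = h / (1 - ω * h) := by field_simp
  simp only
  rw [hw, smul_add, smul_smul, e2, e, smul_add, smul_smul, add_smul, one_smul]
  abel

lemma eLpNorm_euler_step_le {A : Set (Lp ℝ 1 μ × Lp ℝ 1 μ)} {ω h : ℝ}
    (hres : HasCompleteResolvent (opAddSmulId A ω)) (hh : 0 < h) (hωh : ω * h < 1)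
    {w u : Lp ℝ 1 μ} (hwu : (w, u) ∈ resolventGraph h A) {r : ℝ≥0∞} (hr : 1 ≤ r) :
    eLpNorm u r μ ≤ ENNReal.ofReal (1 - ω * h)⁻¹ * eLpNorm w r μ := by
  have h0 : 0 < 1 - ω * h := by linarith
  have h1 := (hres _ (div_pos hh h0)).eLpNorm_le (euler_step_mem hh hωh hwu) hr
  refine h1.trans (le_of_eq ?_)
  simp only
  rw [eLpNorm_congr_ae (Lp.coeFn_smul _ w), eLpNorm_const_smul, Real.enorm_eq_ofReal_abs,
    abs_of_pos (inv_pos.2 h0)]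

lemma euler_step_mem_LOneInter {A : Set (Lp ℝ 1 μ × Lp ℝ 1 μ)} {ω h : ℝ}
    (hres : HasCompleteResolvent (opAddSmulId A ω)) (hh : 0 < h) (hωh : ω * h < 1)
    {w u : Lp ℝ 1 μ} (hwu : (w, u) ∈ resolventGraph h A) (hw : w ∈ LOneInter μ) :
    u ∈ LOneInter μ :=
  ⟨Lp.aestronglyMeasurable u, (eLpNorm_euler_step_le hres hh hωh hwu le_top).trans_lt
    (ENNReal.mul_lt_top ENNReal.ofReal_lt_top hw.2)⟩

lemma rNorm_euler_step_le {A : Set (Lp ℝ 1 μ × Lp ℝ 1 μ)} {ω h : ℝ}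
    (hres : HasCompleteResolvent (opAddSmulId A ω)) (hh : 0 < h) (hωh : ω * h < 1)
    {w u : Lp ℝ 1 μ} (hwu : (w, u) ∈ resolventGraph h A) (hw : w ∈ LOneInter μ)
    {r : ℝ≥0∞} (hr : 1 ≤ r) : rNorm r u ≤ (1 - ω * h)⁻¹ * rNorm r w := by
  have h0 : 0 < 1 - ω * h := by linarith
  have h1 := eLpNorm_euler_step_le hres hh hωh hwu hr
  have h2 := ENNReal.toReal_mono
    (ENNReal.mul_lt_top ENNReal.ofReal_lt_top (memLp_of_mem_LOneInter hw hr).2).ne h1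
  rwa [ENNReal.toReal_mul, ENNReal.toReal_ofReal (inv_pos.2 h0).le] at h2

/-- Since w = u + hv, taking λ = h in the infimum bounds the bracket by the decrease of the q-norm
over the step. -/
lemma SatisfiesGN.euler_step {A : Set (Lp ℝ 1 μ × Lp ℝ 1 μ)} {q σ ϱ ω C h : ℝ} {r : ℝ≥0∞}
    (hGN : SatisfiesGN (opTrace A) 0 q r σ ϱ ω C) (hq : 1 ≤ q) (hC : 0 < C) (hh : 0 < h)
    {w u : Lp ℝ 1 μ} (hwu : (w, u) ∈ resolventGraph h A) (hw : w ∈ LOneInter μ)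
    (hu : u ∈ LOneInter μ) :
    rNorm r u ^ σ ≤ C * ((1 / q * qNorm q w ^ q - 1 / q * qNorm q u ^ q) / h +
      ω * qNorm q u ^ q) * qNorm q u ^ ϱ := by
  obtain ⟨v, hv, hwv⟩ := hwu
  simp only at hv hwv
  have hvm : v ∈ LOneInter μ := by
    have : v = h⁻¹ • (w - u) := by
      rw [hwv, add_sub_cancel_left, smul_smul, inv_mul_cancel₀ hh.ne', one_smul]
    rw [this]
    exact LOneInter_smul (LOneInter_sub hw hu) _
  have h1 := hGN u v ⟨hv, hu, hvm⟩
  rw [sub_zero] at h1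
  refine h1.trans ?_
  have h2 := qBracket_le hu hvm hq hh
  rw [← hwv] at h2
  have := Real.rpow_nonneg (qNorm_nonneg q u) ϱ
  gcongr

lemma IsMildSolution.exists_euler {A : Set (Lp ℝ 1 μ × Lp ℝ 1 μ)} {u : Lp ℝ 1 μ}
    {x : ℝ → Lp ℝ 1 μ} (hx : IsMildSolution A u x) {s t ε : ℝ} (hs : 0 ≤ s) (hst : s < t)
    (hε : 0 < ε) :
    ∃ (N k : ℕ) (τ : ℕ → ℝ) (w : ℕ → Lp ℝ 1 μ), k ≤ N ∧ τ 0 = 0 ∧ τ N = t ∧ w 0 = u ∧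
      |τ k - s| ≤ ε ∧ (s = 0 → k = 0) ∧ ‖x s - w k‖ ≤ ε ∧ ‖x t - w N‖ ≤ ε ∧
      ∀ i < N, τ i < τ (i + 1) ∧ τ (i + 1) - τ i < ε ∧
        (w i, w (i + 1)) ∈ resolventGraph (τ (i + 1) - τ i) A := by
  have ht : 0 < t := hs.trans_lt hst
  obtain ⟨N, τ, w, h0, hN, hw0, hstep⟩ := hx.2.2 t ht ε hε
  have hNpos : N ≠ 0 := by rintro rfl; linarith
  have hend : ‖x t - w N‖ ≤ ε := by
    obtain ⟨m, rfl⟩ := Nat.exists_eq_succ_of_ne_zero hNpos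
    exact (hstep m (by omega)).2.2.2 t ⟨by rw [← hN]; exact (hstep m (by omega)).1, hN.ge⟩
  have hst' : ∀ i < N, τ i < τ (i + 1) ∧ τ (i + 1) - τ i < ε ∧
      (w i, w (i + 1)) ∈ resolventGraph (τ (i + 1) - τ i) A :=
    fun i hi => ⟨(hstep i hi).1, (hstep i hi).2.1, (hstep i hi).2.2.1⟩
  rcases hs.eq_or_lt with rfl | hs0
  · refine ⟨N, 0, τ, w, Nat.zero_le _, h0, hN, hw0, by rw [h0]; simpa using hε.le, fun _ => rfl,
      ?_, hend, hst'⟩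
    rw [hx.2.1, hw0]; simpa using hε.le
  · classical
    -- The first grid point not before s: then s lies in the half-open cell ending there. At s = 0,
    -- which no cell contains, k = 0 was used, and w 0 = u holds exactly.
    have hex : ∃ k, s ≤ τ k := ⟨N, by linarith⟩
    have hk := Nat.find_spec hex
    have hkN : Nat.find hex ≤ N := Nat.find_min' hex (by linarith)
    have hk0 : Nat.find hex ≠ 0 := by
      intro hz; rw [hz, h0] at hk; linarith
    obtain ⟨m, hm⟩ := Nat.exists_eq_succ_of_ne_zero hk0
    have hm1 : τ m < s := not_le.1 (Nat.find_min hex (m := m) (by omega))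
    rw [hm] at hk hkN
    have hmm := hstep m (by omega)
    refine ⟨N, m + 1, τ, w, hkN, h0, hN, hw0, ?_, fun h => absurd h hs0.ne', ?_, hend, hst'⟩
    · rw [abs_of_nonneg (by simpa using hk)]
      simp only [Nat.succ_eq_add_one] at hk
      linarith [hmm.2.1]
    · exact hmm.2.2.2 s ⟨hm1, hk⟩

/-- Approximation of the values of a mild solution at two times by values of the implicit Euler
scheme that satisfy the discrete growth and smoothing estimates. -/
lemma IsMildSolution.exists_approx {A : Set (Lp ℝ 1 μ × Lp ℝ 1 μ)} {ω : ℝ} (hω : 0 ≤ ω)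
    (hres : HasCompleteResolvent (opAddSmulId A ω)) {u : Lp ℝ 1 μ} (hu : u ∈ LOneInter μ)
    {x : ℝ → Lp ℝ 1 μ} (hx : IsMildSolution A u x) {s t : ℝ} (hs : 0 ≤ s) (hst : s < t)
    {q : ℝ} (hq : 1 ≤ q) :
    ∃ (L Ω : ℕ → ℝ) (W Y : ℕ → Lp ℝ 1 μ), Tendsto L atTop (𝓝 (t - s)) ∧
      Tendsto Ω atTop (𝓝 ω) ∧ Tendsto W atTop (𝓝 (x t)) ∧ Tendsto Y atTop (𝓝 (x s)) ∧
      (s = 0 → ∀ n, Y n = u) ∧ (∀ n, W n ∈ LOneInter μ) ∧ (∀ n, Y n ∈ LOneInter μ) ∧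
      (∀ n r, 1 ≤ r → rNorm r (W n) ≤ Real.exp (Ω n * L n) * rNorm r (Y n)) ∧
      (∃ M, ∀ n, rNorm ∞ (Y n) ≤ M) ∧
      ∀ n (r : ℝ≥0∞) (σ ϱ C : ℝ), 1 ≤ r → 0 < σ → 0 ≤ ϱ → 0 < C →
        SatisfiesGN (opTrace A) 0 q r σ ϱ ω C →
        L n * rNorm r (W n) ^ σ ≤
          C / q * Real.exp (Ω n * L n * (σ + q + ϱ)) * qNorm q (Y n) ^ (q + ϱ) := by
  have hq0 : 0 < q := by linarith
  -- Mesh bounds tending to 0 with qωδ ≤ 1/2, so that every denominator below stays at least 1/2.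
  set δ : ℕ → ℝ := fun n => 1 / (2 * (q * ω + 1)) * (1 / ((n : ℝ) + 1)) with hδ
  have hD : 0 < 2 * (q * ω + 1) := by positivity
  have hδ0 : ∀ n, 0 < δ n := fun n => by simp only [hδ]; positivity
  have hδlim : Tendsto δ atTop (𝓝 0) := by
    have := (tendsto_one_div_add_atTop_nhds_zero_nat (𝕜 := ℝ)).const_mul (1 / (2 * (q * ω + 1)))
    rwa [mul_zero] at this
  have hδq : ∀ n, q * ω * δ n ≤ 1 / 2 := by
    intro n
    have h1 : δ n ≤ 1 / (2 * (q * ω + 1)) := by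
      refine mul_le_of_le_one_right (by positivity) ?_
      rw [div_le_one (by positivity)]
      linarith [(Nat.cast_nonneg n : (0 : ℝ) ≤ n)]
    have h2 := mul_le_mul_of_nonneg_left h1 (by positivity : 0 ≤ q * ω)
    refine h2.trans ?_
    rw [mul_one_div, div_le_div_iff₀ hD (by norm_num)]
    nlinarith
  choose N k τ w hkN hτ0 hτN hw0 hτk hk0 hws hwt hstep using
    fun n => hx.exists_euler hs hst (hδ0 n)
  -- One rate for two purposes: it discounts the factor 1 - qωh in the bracket estimate and, because
  -- q ≥ 1, also dominates the growth factor (1 - ωh)⁻¹ of all r-norms.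
  set Ω : ℕ → ℝ := fun n => ω / (1 - q * ω * δ n) with hΩ
  have hΩ0 : ∀ n, 0 ≤ Ω n := fun n => div_nonneg hω (by linarith [hδq n])
  have hexp : ∀ n, ∀ i < N n, Real.exp (-(q * Ω n * (τ n (i + 1) - τ n i))) ≤
      1 - q * ω * (τ n (i + 1) - τ n i) := by
    intro n i hi
    have h := hstep n i hi
    have := exp_neg_le_one_sub (c := q * ω) (by positivity) (sub_nonneg.2 h.1.le) h.2.1.le
      (by linarith [hδq n])
    rwa [mul_div_assoc] at this
  have hωq : ω ≤ q * ω := by nlinarith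
  have hωh : ∀ n, ∀ i < N n, ω * (τ n (i + 1) - τ n i) < 1 := by
    intro n i hi
    have h := hstep n i hi
    have h1 := mul_le_mul hωq h.2.1.le (sub_nonneg.2 h.1.le) (by positivity)
    linarith [hδq n]
  have hmem : ∀ n, ∀ i ≤ N n, w n i ∈ LOneInter μ := by
    intro n i
    induction i with
    | zero => intro _; rw [hw0 n]; exact hu
    | succ i ih =>
      intro hi
      have h := hstep n i (by omega)
      exact euler_step_mem_LOneInter hres (sub_pos.2 h.1) (hωh n i (by omega)) h.2.2
        (ih (by omega))
  have hdec : ∀ n (r : ℝ≥0∞), 1 ≤ r → ∀ i < N n, rNorm r (w n (i + 1)) ≤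
      Real.exp (Ω n * (τ n (i + 1) - τ n i)) * rNorm r (w n i) := by
    intro n r hr i hi
    have h := hstep n i hi
    refine (rNorm_euler_step_le hres (sub_pos.2 h.1) (hωh n i hi) h.2.2
      (hmem n i hi.le) hr).trans ?_
    refine mul_le_mul_of_nonneg_right ?_ (rNorm_nonneg _ _)
    have h1 := exp_neg_le_one_sub hω (sub_nonneg.2 h.1.le) h.2.1.le
      (by have := mul_le_mul_of_nonneg_right hωq (hδ0 n).le
          linarith [hδq n])
    rw [inv_le_comm₀ (by linarith [hωh n i hi]) (Real.exp_pos _), ← Real.exp_neg]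
    refine le_trans (Real.exp_le_exp.2 (neg_le_neg ?_)) h1
    refine mul_le_mul_of_nonneg_right ?_ (sub_nonneg.2 h.1.le)
    refine div_le_div_of_nonneg_left hω (by linarith [hδq n]) ?_
    have := mul_le_mul_of_nonneg_right hωq (hδ0 n).le
    linarith
  refine ⟨fun n => τ n (N n) - τ n (k n), Ω, fun n => w n (N n), fun n => w n (k n), ?_, ?_, ?_,
    ?_, ?_, fun n => hmem n _ le_rfl, fun n => hmem n _ (hkN n), ?_, ?_, ?_⟩
  · have : Tendsto (fun n => τ n (k n)) atTop (𝓝 s) := by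
      rw [tendsto_iff_norm_sub_tendsto_zero]
      exact squeeze_zero (fun _ => norm_nonneg _) (fun n => hτk n) hδlim
    simp only [hτN]
    exact this.const_sub t
  · have h1 : Tendsto (fun n => 1 - q * ω * δ n) atTop (𝓝 (1 - q * ω * 0)) :=
      (hδlim.const_mul _).const_sub 1
    have h2 := (tendsto_const_nhds (x := ω)).div h1 (by simp)
    simp only [mul_zero, sub_zero, div_one] at h2
    exact h2
  · rw [tendsto_iff_norm_sub_tendsto_zero]
    refine squeeze_zero (fun _ => norm_nonneg _) (fun n => ?_) hδlim
    rw [norm_sub_rev]; exact hwt n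
  · rw [tendsto_iff_norm_sub_tendsto_zero]
    refine squeeze_zero (fun _ => norm_nonneg _) (fun n => ?_) hδlim
    rw [norm_sub_rev]; exact hws n
  · intro h n
    simp only [hk0 n h, hw0]
  · intro n r hr
    have h1 := le_exp_mul_of_step (t := fun i => τ n (k n + i))
      (n := fun i => rNorm r (w n (k n + i))) (Ω := Ω n) (M := N n - k n)
      (fun i hi => hdec n r hr (k n + i) (by omega)) _ le_rfl
    simpa [Nat.add_sub_cancel' (hkN n)] using h1
  · refine ⟨Real.exp (2 * ω * t) * rNorm ∞ u, fun n => ?_⟩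
    have h1 := le_exp_mul_of_step (t := τ n) (n := fun i => rNorm ∞ (w n i)) (Ω := Ω n)
      (hdec n ∞ le_top) (k n) (hkN n)
    simp only [hw0, hτ0, sub_zero] at h1
    refine h1.trans (mul_le_mul_of_nonneg_right (Real.exp_le_exp.2 ?_) (rNorm_nonneg _ _))
    have h2 : Ω n ≤ 2 * ω := by
      rw [hΩ, div_le_iff₀ (by linarith [hδq n])]
      nlinarith [hδq n]
    have h3 : τ n (k n) ≤ t := by
      rw [← hτN n]
      have : ∀ j, k n ≤ j → j ≤ N n → τ n (k n) ≤ τ n j := by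
        intro j hj
        induction j, hj using Nat.le_induction with
        | base => intro _; exact le_rfl
        | succ j hj ih => intro hjN; exact (ih (by omega)).trans (hstep n j (by omega)).1.le
      exact this _ (hkN n) le_rfl
    calc Ω n * τ n (k n) ≤ Ω n * t := mul_le_mul_of_nonneg_left h3 (hΩ0 n)
      _ ≤ 2 * ω * t := mul_le_mul_of_nonneg_right h2 (hs.trans hst.le)
  · intro n r σ ϱ C hr hσ hϱ hC hGN
    have h1 := discrete_smoothing (t := fun i => τ n (k n + i))
      (x := fun i => rNorm r (w n (k n + i))) (n := fun i => qNorm q (w n (k n + i)))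
      (Ω := Ω n) (ω := ω) (M := N n - k n) (hΩ0 n) hq hσ hϱ hC (fun _ => rNorm_nonneg _ _)
      (fun _ => qNorm_nonneg _ _) (fun i hi => (hstep n (k n + i) (by omega)).1)
      (fun i hi => hdec n r hr (k n + i) (by omega))
      (fun i hi => hdec n _ (one_le_ofReal hq) (k n + i) (by omega))
      (fun i hi => hexp n (k n + i) (by omega))
      (fun i hi => hGN.euler_step hq hC (sub_pos.2 (hstep n (k n + i) (by omega)).1)
        (hstep n (k n + i) (by omega)).2.2 (hmem n _ (by omega)) (hmem n _ (by omega)))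
    simpa [Nat.add_sub_cancel' (hkN n)] using h1

end Euler

/-! ### Passage to the limit: growth and smoothing of mild solutions -/

section Mild

variable {α : Type*} [MeasurableSpace α] {μ : Measure α}
  {A : Set (Lp ℝ 1 μ × Lp ℝ 1 μ)} {ω : ℝ} {u : Lp ℝ 1 μ} {x : ℝ → Lp ℝ 1 μ}

/-- Starting at time 0 the approximants of the initial value equal u, so no convergence of norms is
needed on the right and r = ∞ is allowed. This keeps the orbit in L¹ ∩ L^∞. -/
lemma IsMildSolution.eLpNorm_le (hx : IsMildSolution A u x) (hω : 0 ≤ ω)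
    (hres : HasCompleteResolvent (opAddSmulId A ω)) (hu : u ∈ LOneInter μ) {t : ℝ} (ht : 0 < t)
    {r : ℝ≥0∞} (hr : 1 ≤ r) :
    eLpNorm (x t) r μ ≤ ENNReal.ofReal (Real.exp (ω * t) * rNorm r u) := by
  obtain ⟨L, Ω, W, Y, hL, hΩ, hW, -, hY0, hWm, -, hdec, -, -⟩ :=
    hx.exists_approx hω hres hu le_rfl ht le_rfl
  rw [sub_zero] at hL
  refine eLpNorm_le_of_tendsto hW (B := fun n => Real.exp (Ω n * L n) * rNorm r u)
    (((Real.continuous_exp.tendsto _).comp (hΩ.mul hL)).mul_const _) (Eventually.of_forall ?_)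
  intro n
  rw [← ofReal_rNorm (hWm n) hr]
  refine ENNReal.ofReal_le_ofReal ?_
  have := hdec n r hr
  rwa [hY0 rfl n] at this

lemma IsMildSolution.mem_LOneInter (hx : IsMildSolution A u x) (hω : 0 ≤ ω)
    (hres : HasCompleteResolvent (opAddSmulId A ω)) (hu : u ∈ LOneInter μ) {t : ℝ} (ht : 0 ≤ t) :
    x t ∈ LOneInter μ := by
  rcases ht.eq_or_lt with rfl | ht
  · rw [hx.2.1]; exact hu
  · exact ⟨Lp.aestronglyMeasurable _,
      (hx.eLpNorm_le hω hres hu ht le_top).trans_lt ENNReal.ofReal_lt_top⟩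

lemma IsMildSolution.rNorm_top_le (hx : IsMildSolution A u x) (hω : 0 ≤ ω)
    (hres : HasCompleteResolvent (opAddSmulId A ω)) (hu : u ∈ LOneInter μ) {t : ℝ} (ht : 0 < t) :
    rNorm ∞ (x t) ≤ Real.exp (ω * t) * rNorm ∞ u :=
  ENNReal.toReal_le_of_le_ofReal (mul_nonneg (Real.exp_pos _).le (rNorm_nonneg _ _))
    (hx.eLpNorm_le hω hres hu ht le_top)

lemma IsMildSolution.qNorm_le (hx : IsMildSolution A u x) (hω : 0 ≤ ω)
    (hres : HasCompleteResolvent (opAddSmulId A ω)) (hu : u ∈ LOneInter μ) {s t : ℝ}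
    (hs : 0 ≤ s) (hst : s < t) {q : ℝ} (hq : 1 ≤ q) :
    qNorm q (x t) ≤ Real.exp (ω * (t - s)) * qNorm q (x s) := by
  obtain ⟨L, Ω, W, Y, hL, hΩ, hW, hY, -, hWm, hYm, hdec, ⟨M, hM⟩, -⟩ :=
    hx.exists_approx hω hres hu hs hst le_rfl
  have hxs := hx.mem_LOneInter hω hres hu hs
  refine ENNReal.toReal_le_of_le_ofReal (mul_nonneg (Real.exp_pos _).le (qNorm_nonneg _ _))
    (eLpNorm_le_of_tendsto hW (B := fun n => Real.exp (Ω n * L n) * qNorm q (Y n))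
    (((Real.continuous_exp.tendsto _).comp (hΩ.mul hL)).mul (tendsto_qNorm hY hxs hYm hM hq))
    (Eventually.of_forall fun n => ?_))
  rw [← ofReal_rNorm (hWm n) (one_le_ofReal hq)]
  exact ENNReal.ofReal_le_ofReal (hdec n _ (one_le_ofReal hq))

/-- The limit of the discrete estimate after taking σ-th roots; (σ + q + ϱ)/σ is the exponent β = γ
+ 1. An arbitrary initial time s is what the Moser iteration requires. -/
lemma IsMildSolution.smoothing (hx : IsMildSolution A u x) (hω : 0 ≤ ω)
    (hres : HasCompleteResolvent (opAddSmulId A ω)) (hu : u ∈ LOneInter μ) {s t : ℝ}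
    (hs : 0 ≤ s) (hst : s < t) {q σ ϱ C : ℝ} {r : ℝ≥0∞} (hq : 1 ≤ q) (hr : 1 ≤ r) (hσ : 0 < σ)
    (hϱ : 0 ≤ ϱ) (hC : 0 < C) (hGN : SatisfiesGN (opTrace A) 0 q r σ ϱ ω C) :
    eLpNorm (x t) r μ ≤ ENNReal.ofReal ((C / q) ^ (1 / σ) * (t - s) ^ (-(1 / σ)) *
      Real.exp (ω * ((q + ϱ) / σ + 1) * (t - s)) * qNorm q (x s) ^ ((q + ϱ) / σ)) := by
  obtain ⟨L, Ω, W, Y, hL, hΩ, hW, hY, -, hWm, hYm, -, ⟨M, hM⟩, hsm⟩ :=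
    hx.exists_approx hω hres hu hs hst hq
  have hxs := hx.mem_LOneInter hω hres hu hs
  have hts : 0 < t - s := sub_pos.2 hst
  have hCq : 0 < C / q := by positivity
  have hlim : Tendsto (fun n => (C / q) ^ (1 / σ) * L n ^ (-(1 / σ)) *
      Real.exp (Ω n * ((q + ϱ) / σ + 1) * L n) * qNorm q (Y n) ^ ((q + ϱ) / σ)) atTop
      (𝓝 ((C / q) ^ (1 / σ) * (t - s) ^ (-(1 / σ)) *
      Real.exp (ω * ((q + ϱ) / σ + 1) * (t - s)) * qNorm q (x s) ^ ((q + ϱ) / σ))) := by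
    refine (((hL.rpow_const (Or.inl hts.ne')).const_mul _).mul
      ((Real.continuous_exp.tendsto _).comp ((hΩ.mul_const _).mul hL))).mul
      ((tendsto_qNorm hY hxs hYm hM hq).rpow_const (Or.inr (by positivity)))
  refine eLpNorm_le_of_tendsto hW hlim ?_
  filter_upwards [hL.eventually_const_lt hts] with n hn
  rw [← ofReal_rNorm (hWm n) hr]
  refine ENNReal.ofReal_le_ofReal ?_
  have h1 := hsm n r σ ϱ C hr hσ hϱ hC hGN
  have hN := qNorm_nonneg q (Y n)
  have h2 : rNorm r (W n) ^ σ ≤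
      (C / q) * (L n)⁻¹ * Real.exp (Ω n * L n * (σ + q + ϱ)) * qNorm q (Y n) ^ (q + ϱ) := by
    rw [← le_div_iff₀' hn] at h1
    refine h1.trans (le_of_eq ?_)
    field_simp
  have h3 := Real.rpow_le_rpow (Real.rpow_nonneg (rNorm_nonneg _ _) _) h2
    (by positivity : 0 ≤ 1 / σ)
  rw [← Real.rpow_mul (rNorm_nonneg _ _), mul_one_div_cancel hσ.ne', Real.rpow_one] at h3
  refine h3.trans (le_of_eq ?_)
  rw [Real.mul_rpow (by positivity) (by positivity), Real.mul_rpow (by positivity) (by positivity),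
    Real.mul_rpow (by positivity) (by positivity), Real.inv_rpow hn.le, ← Real.rpow_neg hn.le,
    ← Real.rpow_mul hN, ← Real.exp_mul]
  have e1 : Ω n * L n * (σ + q + ϱ) * (1 / σ) = Ω n * ((q + ϱ) / σ + 1) * L n := by
    field_simp; ring
  rw [e1, mul_one_div (q + ϱ) σ]

end Mild

/-! ### Absorption of a sublinear power -/

section Iteration

/-- The supremum S of τ^B φ(τ) over (0, t] satisfies S ≤ D'S^θ, hence S ≤ D'^{1/(1-θ)}. The bound M
serves only to make S finite and does not enter the result. -/
lemma le_of_le_mul_half_rpow {φ : ℝ → ℝ} {t a D θ M : ℝ} (ht : 0 < t) (ha : 0 ≤ a) (hD : 0 ≤ D)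
    (hθ0 : 0 ≤ θ) (hθ1 : θ < 1) (hφ0 : ∀ τ, 0 ≤ φ τ) (hM : ∀ τ, 0 < τ → τ ≤ t → φ τ ≤ M)
    (h : ∀ τ, 0 < τ → τ ≤ t → φ τ ≤ D * τ ^ (-a) * φ (τ / 2) ^ θ) :
    φ t ≤ (D * 2 ^ (a / (1 - θ) * θ)) ^ (1 / (1 - θ)) * t ^ (-(a / (1 - θ))) := by
  have hθ : 0 < 1 - θ := by linarith
  -- The weight exponent for which B - a = Bθ, so that the inequality between τ and τ/2 becomes
  -- scale invariant.
  set B := a / (1 - θ) with hB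
  have hB0 : 0 ≤ B := by positivity
  have hBa : B - a = B * θ := by rw [hB]; field_simp; ring
  set D' := D * 2 ^ (B * θ) with hD'
  have hD'0 : 0 ≤ D' := by positivity
  set ψ : ℝ → ℝ := fun τ => τ ^ B * φ τ with hψ
  have hψ0 : ∀ τ, 0 < τ → 0 ≤ ψ τ := fun τ hτ =>
    mul_nonneg (Real.rpow_nonneg hτ.le _) (hφ0 τ)
  set S := sSup (ψ '' Ioc 0 t) with hS
  have hbdd : BddAbove (ψ '' Ioc 0 t) := by
    refine ⟨t ^ B * M, ?_⟩
    rintro _ ⟨τ, hτ, rfl⟩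
    exact mul_le_mul (Real.rpow_le_rpow hτ.1.le hτ.2 hB0) (hM τ hτ.1 hτ.2) (hφ0 τ)
      (Real.rpow_nonneg ht.le _)
  have hle : ∀ τ ∈ Ioc 0 t, ψ τ ≤ S := fun τ hτ => le_csSup hbdd ⟨τ, hτ, rfl⟩
  have hS0 : 0 ≤ S := (hψ0 t ht).trans (hle t ⟨ht, le_rfl⟩)
  have hSθ : S ≤ D' * S ^ θ := by
    refine csSup_le ⟨ψ t, t, ⟨ht, le_rfl⟩, rfl⟩ ?_
    rintro _ ⟨τ, hτ, rfl⟩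
    have hτ0 := hτ.1
    have h2 : 0 < τ / 2 := by linarith
    calc ψ τ ≤ τ ^ B * (D * τ ^ (-a) * φ (τ / 2) ^ θ) := by
          simp only [hψ]
          gcongr
          exact h τ hτ.1 hτ.2
      _ = D * τ ^ (B * θ) * φ (τ / 2) ^ θ := by
          rw [← hBa, sub_eq_add_neg, Real.rpow_add hτ0]; ring
      _ = D' * ψ (τ / 2) ^ θ := by
          simp only [hψ, hD']
          rw [Real.mul_rpow (by positivity) (hφ0 _), ← Real.rpow_mul h2.le,
            Real.div_rpow hτ0.le (by norm_num)]
          field_simp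
      _ ≤ D' * S ^ θ := by
          have := hψ0 _ h2
          gcongr
          exact hle _ ⟨h2, by linarith [hτ.2]⟩
  have hSD : S ≤ D' ^ (1 / (1 - θ)) := by
    rcases hS0.eq_or_lt with h0 | hpos
    · rw [← h0]; positivity
    · have h3 : S ^ (1 - θ) ≤ D' := by
        rw [Real.rpow_sub hpos, Real.rpow_one, div_le_iff₀ (Real.rpow_pos_of_pos hpos _)]
        exact hSθ
      have h4 := Real.rpow_le_rpow (Real.rpow_nonneg hS0 _) h3 (by positivity : 0 ≤ 1 / (1 - θ))
      rwa [← Real.rpow_mul hS0, mul_one_div_cancel hθ.ne', Real.rpow_one] at h4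
  have h5 := (hle t ⟨ht, le_rfl⟩).trans hSD
  rw [Real.rpow_neg ht.le, ← div_eq_mul_inv, le_div_iff₀ (Real.rpow_pos_of_pos ht _), mul_comm]
  exact h5

end Iteration

/-! ### Moser iteration -/

section Moser

lemma rpow_step {y y' X δ E Q σ K : ℝ} (hy : 0 ≤ y) (hy' : 0 ≤ y') (hX : 0 ≤ X) (hδ : 0 < δ)
    (hσ : 0 < σ) (hK : 0 < K)
    (h : y ≤ X ^ (1 / σ) * δ ^ (-(1 / σ)) * Real.exp E * y' ^ (Q / σ)) :
    y ^ (σ / K) ≤ (X / δ) ^ (1 / K) * Real.exp (E * σ / K) * y' ^ (Q / K) := by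
  have h1 := Real.rpow_le_rpow hy h (by positivity : 0 ≤ σ / K)
  refine h1.trans (le_of_eq ?_)
  rw [Real.mul_rpow (by positivity) (by positivity), Real.mul_rpow (by positivity) (by positivity),
    Real.mul_rpow (by positivity) (by positivity), ← Real.rpow_mul hX, ← Real.rpow_mul hδ.le,
    ← Real.rpow_mul hy', ← Real.exp_mul, Real.div_rpow hX hδ.le, div_eq_mul_inv (X ^ (1 / K)),
    ← Real.rpow_neg hδ.le]
  have e1 : 1 / σ * (σ / K) = 1 / K := by field_simp
  have e2 : -(1 / σ) * (σ / K) = -(1 / K) := by field_simp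
  have e3 : Q / σ * (σ / K) = Q / K := by field_simp
  rw [e1, e2, e3, mul_div_assoc]

lemma summable_moser {κ : ℝ} (hκ : 1 < κ) (a b : ℝ) :
    Summable fun k : ℕ => (a + (k + 1) * b) * κ⁻¹ ^ (k + 1) := by
  have hκ1 : ‖κ⁻¹‖ < 1 := by
    rw [Real.norm_of_nonneg (by positivity)]; exact inv_lt_one_of_one_lt₀ hκ
  have h0 := summable_geometric_of_norm_lt_one hκ1
  have h1 : Summable fun k : ℕ => (k : ℝ) * κ⁻¹ ^ k := by
    simpa using summable_pow_mul_geometric_of_norm_lt_one 1 hκ1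
  refine ((h0.mul_left ((a + b) * κ⁻¹)).add (h1.mul_left (b * κ⁻¹))).congr fun k => ?_
  rw [pow_succ]; ring

/-- N r τ plays the role of the r-norm at time τ. Taking suitable powers turns the chain of
smoothing estimates into a product whose logarithms are summable; Λ and G depend on the structural
parameters only, not on ω, the solution or the times. -/
lemma exists_moser_bound {κ m p q₀ C : ℝ} (hκ : 1 < κ) (hm : 0 < m) (hp : 1 ≤ p) (hpq : p ≤ q₀)
    (hD : 0 < (κ - 1) * q₀ + p - 1 - 1 / m) (hC : 0 < C) :
    ∃ Λ G : ℝ, 0 ≤ G ∧ ∀ (ω : ℝ) (N : ℝ → ℝ → ℝ) (s t : ℝ), 0 ≤ ω → (∀ r τ, 0 ≤ N r τ) →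
      s < t →
      (∀ q, q₀ ≤ q → ∀ s', s ≤ s' → s' < t →
        N (κ * m * q) t ≤ Real.exp (ω * (t - s')) * N (κ * m * q) s') →
      (∀ q, q₀ ≤ q → ∀ s' t', s ≤ s' → s' < t' →
        N (κ * m * q) t' ≤ (C * (q / p) ^ p / (q - p + 1) / ((q - p + 1) * m + 1)) ^ (1 / (m * q)) *
          (t' - s') ^ (-(1 / (m * q))) *
          Real.exp (ω * (((q - p + 1) * m + 1) / (m * q) + 1) * (t' - s')) *
          N ((q - p + 1) * m + 1) s' ^ (((q - p + 1) * m + 1) / (m * q))) →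
      ∃ r B : ℕ → ℝ, Tendsto r atTop atTop ∧
        Tendsto B atTop (𝓝 ((Real.exp (Λ + ω * G * (t - s)) * (t - s) ^ (-(1 / (κ - 1))) *
          N (κ * m * q₀) s ^ (m * q₀)) ^
            ((κ - 1) / (m * ((κ - 1) * q₀ + p - 1 - 1 / m))))) ∧
        ∀ n, N (r n) t ≤ B n := by
  have hκ0 : 0 < κ := by linarith
  have hκ1 : 0 < κ - 1 := by linarith
  have hq₀1 : 1 ≤ q₀ := hp.trans hpq
  -- The recursion Q ↦ κQ + p - 1 - 1/m, which matches the output exponent of one step with the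
  -- input exponent of the next, has fixed point -d; therefore Q_n + d = κ^n(q₀ + d).
  set d := (p - 1 - 1 / m) / (κ - 1) with hd
  have hdκ : d * (κ - 1) = p - 1 - 1 / m := by rw [hd]; field_simp
  have hqd : (q₀ + d) * (κ - 1) = (κ - 1) * q₀ + p - 1 - 1 / m := by
    rw [add_mul, hdκ]; ring
  have hqd0 : 0 < q₀ + d := by
    refine pos_of_mul_pos_left ?_ hκ1.le
    rw [hqd]; exact hD
  set Q : ℕ → ℝ := fun n => κ ^ n * (q₀ + d) - d with hQ
  have hκn : ∀ n : ℕ, 0 < κ ^ n := fun n => by positivity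
  have hQ0 : Q 0 = q₀ := by simp [hQ]
  have hQge : ∀ n, q₀ ≤ Q n := by
    intro n
    have h1 : (1 : ℝ) ≤ κ ^ n := one_le_pow₀ hκ.le
    have := mul_le_mul_of_nonneg_right h1 hqd0.le
    simp only [hQ]; linarith
  have hQs : ∀ n, (Q (n + 1) - p + 1) * m + 1 = κ * m * Q n := by
    intro n
    have : Q (n + 1) = κ * Q n + (p - 1 - 1 / m) := by
      simp only [hQ]; rw [← hdκ, pow_succ]; ring
    rw [this]; field_simp; ring
  set H := q₀ + d + |d| with hH
  have hH0 : 0 < H := by positivity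
  have hQH : ∀ n, Q n ≤ H * κ ^ n := by
    intro n
    have h1 : (1 : ℝ) ≤ κ ^ n := one_le_pow₀ hκ.le
    have h2 := mul_le_mul_of_nonneg_left h1 (abs_nonneg d)
    have h3 := neg_abs_le d
    simp only [hQ, hH]; linarith
  set c := max 1 (C * H ^ p) with hc
  set b := 2 * κ ^ p with hb
  have hc0 : 0 < c := by positivity
  have hb0 : 0 < b := by positivity
  have hb1 : 1 ≤ b := by
    have := Real.one_le_rpow hκ.le (by linarith : 0 ≤ p)
    rw [hb]; linarith
  have hc1 : 1 ≤ c := le_max_left _ _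
  -- The factor 2^{n+1} comes from the length δ2^{-(n+1)} of the n-th time step. The constants grow
  -- only geometrically because Q_n ≤ Hκ^n.
  have hconst : ∀ n, C * (Q (n + 1) / p) ^ p / (Q (n + 1) - p + 1) /
      ((Q (n + 1) - p + 1) * m + 1) * 2 ^ (n + 1) ≤ c * b ^ (n + 1) := by
    intro n
    have h1 : 1 ≤ Q (n + 1) - p + 1 := by linarith [hQge (n + 1)]
    have hQpos : 0 ≤ Q (n + 1) := by linarith [hQge (n + 1)]
    have h2 : 1 ≤ (Q (n + 1) - p + 1) * m + 1 := by
      have := mul_nonneg (zero_le_one.trans h1) hm.le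
      linarith
    have h3 : (Q (n + 1) / p) ^ p ≤ H ^ p * (κ ^ p) ^ (n + 1) := by
      have e : (κ ^ p) ^ (n + 1) = (κ ^ (n + 1)) ^ p := by
        rw [← Real.rpow_natCast, ← Real.rpow_natCast, ← Real.rpow_mul hκ0.le,
          ← Real.rpow_mul hκ0.le, mul_comm]
      rw [e, ← Real.mul_rpow hH0.le (hκn _).le]
      refine Real.rpow_le_rpow (by positivity) ?_ (by linarith)
      exact (div_le_self hQpos hp).trans (hQH _)
    have h4 : 0 ≤ C * (Q (n + 1) / p) ^ p := by positivity
    calc _ ≤ C * (Q (n + 1) / p) ^ p * 2 ^ (n + 1) := by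
          refine mul_le_mul_of_nonneg_right ?_ (by positivity)
          exact (div_le_self (div_nonneg h4 (by linarith)) h2).trans (div_le_self h4 h1)
      _ ≤ C * (H ^ p * (κ ^ p) ^ (n + 1)) * 2 ^ (n + 1) := by gcongr
      _ = C * H ^ p * b ^ (n + 1) := by rw [hb, mul_pow]; ring
      _ ≤ c * b ^ (n + 1) := by gcongr; exact le_max_right _ _
  set l : ℕ → ℝ := fun k => (Real.log c + (k + 1) * Real.log b) * κ⁻¹ ^ (k + 1) with hl
  have hlsum : Summable l := summable_moser hκ _ _
  have hl0 : ∀ k, 0 ≤ l k := fun k => by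
    have := Real.log_nonneg hc1
    have := Real.log_nonneg hb1
    simp only [hl]; positivity
  -- The rate in step n is ω times m(Q_n/κ^n + Q_{n+1}/κ^{n+1}), and both quotients are at most H.
  set G := 2 * m * H with hG
  have hG0 : 0 ≤ G := by positivity
  refine ⟨∑' k, l k, G, hG0, ?_⟩
  intro ω N s t hω hN hst hgrow hsm
  set δ := t - s with hδ
  have hδ0 : 0 < δ := sub_pos.2 hst
  set S : ℕ → ℝ := fun n => s + δ * (1 - (1 / 2) ^ n) with hS
  have hhalf : ∀ n : ℕ, (0 : ℝ) < (1 / 2) ^ n := fun n => by positivity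
  have hSs : ∀ n, s ≤ S n := by
    intro n
    have : ((1 : ℝ) / 2) ^ n ≤ 1 := pow_le_one₀ (by norm_num) (by norm_num)
    have := mul_nonneg hδ0.le (sub_nonneg.2 this)
    simp only [hS]; linarith
  have hSt : ∀ n, t - S n = δ * (1 / 2) ^ n := by
    intro n; simp only [hS, hδ]; ring
  have hStep : ∀ n, S (n + 1) - S n = δ * (1 / 2) ^ (n + 1) := by
    intro n; simp only [hS]; ring
  set sg : ℕ → ℝ := fun n => ∑ k ∈ Finset.range n, κ⁻¹ ^ (k + 1) with hsg
  -- The power is chosen so that z n enters its recursion linearly: κmQ_n/κ^{n+1} = mQ_n/κ^n.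
  set z : ℕ → ℝ := fun n => N (κ * m * Q n) (S n) ^ (m * Q n / κ ^ n) with hz
  have hQpos : ∀ n, 0 < Q n := fun n => by linarith [hQge n]
  have hz0 : ∀ n, 0 ≤ z n := fun n => Real.rpow_nonneg (hN _ _) _
  have hrec : ∀ n, z (n + 1) ≤ Real.exp (l n) * δ ^ (-(κ⁻¹ ^ (n + 1))) *
      Real.exp (ω * G * δ * (1 / 2) ^ (n + 1)) * z n := by
    intro n
    have hh : 0 < δ * (1 / 2) ^ (n + 1) := by positivity
    have h1 := hsm (Q (n + 1)) (hQge _) (S n) (S (n + 1)) (hSs n)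
      (by rw [← sub_pos, hStep]; exact hh)
    rw [hStep] at h1
    set X := C * (Q (n + 1) / p) ^ p / (Q (n + 1) - p + 1) /
      ((Q (n + 1) - p + 1) * m + 1) with hX
    have hX1 : X * 2 ^ (n + 1) ≤ c * b ^ (n + 1) := hconst n
    have hX0 : 0 ≤ X := by
      have h1 : 0 ≤ Q (n + 1) - p + 1 := by linarith [hQge (n + 1)]
      have := (hQpos (n + 1)).le
      positivity
    rw [hQs n] at h1
    have h2 := rpow_step (hN _ _) (hN _ _) hX0 hh (mul_pos hm (hQpos (n + 1))) (hκn (n + 1)) h1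
    have e1 : κ * m * Q n / κ ^ (n + 1) = m * Q n / κ ^ n := by
      rw [pow_succ]; field_simp
    rw [e1] at h2
    refine h2.trans ?_
    have hK : (1 : ℝ) / κ ^ (n + 1) = κ⁻¹ ^ (n + 1) := by rw [inv_pow, one_div]
    have h3 : (X / (δ * (1 / 2) ^ (n + 1))) ^ (1 / κ ^ (n + 1)) ≤
        Real.exp (l n) * δ ^ (-(κ⁻¹ ^ (n + 1))) := by
      rw [hK]
      have e2 : X / (δ * (1 / 2) ^ (n + 1)) = X * 2 ^ (n + 1) / δ := by
        rw [one_div, inv_pow]; field_simp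
      rw [e2]
      have h4 : X * 2 ^ (n + 1) / δ ≤ c * b ^ (n + 1) / δ := by gcongr
      refine (Real.rpow_le_rpow (by positivity) h4 (by positivity)).trans (le_of_eq ?_)
      rw [Real.div_rpow (by positivity) hδ0.le, div_eq_mul_inv, ← Real.rpow_neg hδ0.le]
      congr 1
      rw [Real.rpow_def_of_pos (by positivity), Real.log_mul (by positivity) (by positivity),
        Real.log_pow]
      simp only [hl]
      push_cast
      rfl
    have h5 : Real.exp (ω * (κ * m * Q n / (m * Q (n + 1)) + 1) * (δ * (1 / 2) ^ (n + 1)) *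
        (m * Q (n + 1)) / κ ^ (n + 1)) ≤ Real.exp (ω * G * δ * (1 / 2) ^ (n + 1)) := by
      refine Real.exp_le_exp.2 ?_
      have hq' := hQpos (n + 1)
      have e3 : ω * (κ * m * Q n / (m * Q (n + 1)) + 1) * (δ * (1 / 2) ^ (n + 1)) *
          (m * Q (n + 1)) / κ ^ (n + 1) =
          ω * (m * (Q n / κ ^ n + Q (n + 1) / κ ^ (n + 1))) * (δ * (1 / 2) ^ (n + 1)) := by
        rw [pow_succ κ]; field_simp
      have h6 : ∀ k, Q k / κ ^ k ≤ H := fun k => (div_le_iff₀ (hκn k)).2 (hQH k)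
      rw [e3, mul_assoc (ω * G)]
      refine mul_le_mul_of_nonneg_right (mul_le_mul_of_nonneg_left ?_ hω) hh.le
      have := mul_le_mul_of_nonneg_left (add_le_add (h6 n) (h6 (n + 1))) hm.le
      rw [hG]; linarith
    have := hz0 n
    exact mul_le_mul_of_nonneg_right (mul_le_mul h3 h5 (Real.exp_pos _).le (by positivity)) this
  have hzn : ∀ n, z n ≤ Real.exp (∑ k ∈ Finset.range n, l k) * δ ^ (-(sg n)) *
      Real.exp (ω * G * δ * (1 - (1 / 2) ^ n)) * z 0 := by
    intro n
    induction n with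
    | zero => simp [hsg]
    | succ n ih =>
      refine (hrec n).trans ((mul_le_mul_of_nonneg_left ih (by positivity)).trans (le_of_eq ?_))
      have e1 : δ ^ (-(sg (n + 1))) = δ ^ (-(κ⁻¹ ^ (n + 1))) * δ ^ (-(sg n)) := by
        rw [← Real.rpow_add hδ0]; congr 1; simp only [hsg]; rw [Finset.sum_range_succ]; ring
      have e2 : Real.exp (ω * G * δ * (1 - (1 / 2) ^ (n + 1))) =
          Real.exp (ω * G * δ * (1 / 2) ^ (n + 1)) * Real.exp (ω * G * δ * (1 - (1 / 2) ^ n)) := by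
        rw [← Real.exp_add]; congr 1; ring
      rw [e1, e2, Finset.sum_range_succ, Real.exp_add]
      ring
  have hz00 : z 0 = N (κ * m * q₀) s ^ (m * q₀) := by
    simp [hz, hQ0, hS]
  rw [hz00] at hzn
  set z₀ := N (κ * m * q₀) s ^ (m * q₀) with hz₀
  have hz₀0 : 0 ≤ z₀ := Real.rpow_nonneg (hN _ _) _
  have hκi : κ⁻¹ < 1 := inv_lt_one_of_one_lt₀ hκ
  have hpow0 : Tendsto (fun n : ℕ => κ⁻¹ ^ n) atTop (𝓝 0) :=
    tendsto_pow_atTop_nhds_zero_of_lt_one (by positivity) hκi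
  have hsglim : Tendsto sg atTop (𝓝 (1 / (κ - 1))) := by
    have h1 := ((hasSum_geometric_of_lt_one (by positivity) hκi).mul_left κ⁻¹).tendsto_sum_nat
    have e : κ⁻¹ * (1 - κ⁻¹)⁻¹ = 1 / (κ - 1) := by
      rw [← mul_inv, mul_sub, mul_one, mul_inv_cancel₀ hκ0.ne', one_div]
    rw [e] at h1
    refine h1.congr fun n => ?_
    simp only [hsg]
    exact Finset.sum_congr rfl fun k _ => by rw [pow_succ]; ring
  have hexpo : Tendsto (fun n => κ ^ n / (m * Q n)) atTop
      (𝓝 ((κ - 1) / (m * ((κ - 1) * q₀ + p - 1 - 1 / m)))) := by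
    have h1 : Tendsto (fun n : ℕ => 1 / (m * ((q₀ + d) - d * κ⁻¹ ^ n))) atTop
        (𝓝 (1 / (m * ((q₀ + d) - d * 0)))) := by
      refine Tendsto.div tendsto_const_nhds (((hpow0.const_mul d).const_sub _).const_mul m) ?_
      rw [mul_zero, sub_zero]; positivity
    have e : 1 / (m * ((q₀ + d) - d * 0)) =
        (κ - 1) / (m * ((κ - 1) * q₀ + p - 1 - 1 / m)) := by
      rw [← hqd, mul_zero, sub_zero, div_eq_div_iff (by positivity) (by positivity)]; ring
    rw [e] at h1
    refine h1.congr fun n => ?_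
    have e2 : Q n = κ ^ n * ((q₀ + d) - d * κ⁻¹ ^ n) := by
      simp only [hQ]; rw [inv_pow]; field_simp
    have h2 : 0 < (q₀ + d) - d * κ⁻¹ ^ n := by
      refine pos_of_mul_pos_right ?_ (hκn n).le
      rw [← e2]; exact hQpos n
    rw [e2]; field_simp
  have he0 : 0 < (κ - 1) / (m * ((κ - 1) * q₀ + p - 1 - 1 / m)) := by positivity
  have hhalf0 : Tendsto (fun n : ℕ => ((1 : ℝ) / 2) ^ n) atTop (𝓝 0) :=
    tendsto_pow_atTop_nhds_zero_of_lt_one (by norm_num) (by norm_num)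
  -- The iteration bounds the norm at the moving time S n. The growth estimate moves it to the fixed
  -- time t, at the cost of a factor that tends to 1.
  refine ⟨fun n => κ * m * Q n, fun n => Real.exp (ω * (δ * (1 / 2) ^ n)) *
    (Real.exp (∑' k, l k + ω * G * δ) * δ ^ (-(sg n)) * z₀) ^ (κ ^ n / (m * Q n)), ?_, ?_, ?_⟩
  · refine Tendsto.const_mul_atTop (by positivity) ?_
    exact tendsto_atTop_add_const_right _ (-d)
      ((tendsto_pow_atTop_atTop_of_one_lt hκ).atTop_mul_const hqd0)
  · have h1 : Tendsto (fun n : ℕ => Real.exp (ω * (δ * (1 / 2) ^ n))) atTop (𝓝 1) := by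
      have := (Real.continuous_exp.tendsto _).comp ((hhalf0.const_mul δ).const_mul ω)
      simpa [Function.comp_def] using this
    have h2 : Tendsto (fun n => δ ^ (-(sg n))) atTop (𝓝 (δ ^ (-(1 / (κ - 1))))) :=
      Tendsto.rpow tendsto_const_nhds hsglim.neg (Or.inl hδ0.ne')
    have h3 := h1.mul (((h2.const_mul (Real.exp (∑' k, l k + ω * G * δ))).mul_const z₀).rpow
      hexpo (Or.inr he0))
    rwa [one_mul] at h3
  · intro n
    have hQn := hQpos n
    have hlt : S n < t := by
      rw [← sub_pos, hSt]; have := hhalf n; positivity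
    have h1 := hgrow (Q n) (hQge n) (S n) (hSs n) hlt
    rw [hSt] at h1
    refine h1.trans (mul_le_mul_of_nonneg_left ?_ (Real.exp_pos _).le)
    have e1 : N (κ * m * Q n) (S n) = z n ^ (κ ^ n / (m * Q n)) := by
      simp only [hz]
      rw [← Real.rpow_mul (hN _ _)]
      have : m * Q n / κ ^ n * (κ ^ n / (m * Q n)) = 1 := by
        have := hκn n
        field_simp
      rw [this, Real.rpow_one]
    rw [e1]
    refine Real.rpow_le_rpow (hz0 n) ((hzn n).trans ?_)
      (div_nonneg (hκn n).le (mul_nonneg hm.le hQn.le))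
    have h3 : ∑ k ∈ Finset.range n, l k ≤ ∑' k, l k := hlsum.sum_le_tsum _ fun k _ => hl0 k
    have h4 : ω * G * δ * (1 - (1 / 2) ^ n) ≤ ω * G * δ :=
      mul_le_of_le_one_right (by positivity) (by linarith [hhalf n])
    have h5 : Real.exp (∑ k ∈ Finset.range n, l k) * δ ^ (-(sg n)) *
        Real.exp (ω * G * δ * (1 - (1 / 2) ^ n)) =
        Real.exp (∑ k ∈ Finset.range n, l k + ω * G * δ * (1 - (1 / 2) ^ n)) * δ ^ (-(sg n)) := by
      rw [Real.exp_add]; ring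
    rw [h5]
    gcongr

end Moser

/-! ### Vanishing of the equilibrium, L^∞ smoothing and extrapolation -/

section Main

variable {α : Type*} [MeasurableSpace α] {μ : Measure α} {A : Set (Lp ℝ 1 μ × Lp ℝ 1 μ)} {ω : ℝ}

lemma HasCCompleteResolvent.hasCompleteResolvent (h : HasCCompleteResolvent A) :
    HasCompleteResolvent A :=
  fun lam hlam j hj z hz => h lam hlam j hj.1 z hz

/-- The range condition solves the resolvent equation with datum 0 inside the trace, and L¹
contractivity forces the solution to be 0. -/
lemma zero_mem_opTrace (hres : HasCompleteResolvent (opAddSmulId A ω))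
    (hrange : LOneInter μ ⊆ opRange (opIdAddSmul 1 (opAddSmulId (opTrace A) ω))) :
    ((0 : Lp ℝ 1 μ), (0 : Lp ℝ 1 μ)) ∈ opTrace A := by
  obtain ⟨u, v', ⟨v, hv, hv'⟩, hw⟩ := hrange LOneInter_zero
  simp only at hv hv' hw
  have h1 := (hres 1 one_pos).eLpNorm_le (z := (0, u)) (r := 1)
    ⟨v', ⟨v, hv.1, hv'⟩, hw⟩ le_rfl
  simp only at h1
  rw [eLpNorm_congr_ae (Lp.coeFn_zero ℝ 1 μ), eLpNorm_zero, nonpos_iff_eq_zero] at h1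
  have hu : u = 0 := eq_zero_of_rNorm_eq_zero hv.2.1 (r := 1) le_rfl (by simp [rNorm, h1])
  subst hu
  have hv0 : v = 0 := by
    rw [hv'] at hw
    simpa using hw.symm
  rwa [hv0] at hv

/-- The Gagliardo-Nirenberg type inequality forces the equilibrium `u₀` to vanish as soon as `0`
is an equilibrium. -/
lemma SatisfiesGN.eq_zero {q σ ϱ C : ℝ} {r : ℝ≥0∞} {u₀ : Lp ℝ 1 μ}
    (hGN : SatisfiesGN (opTrace A) u₀ q r σ ϱ ω C) (hr : 1 ≤ r)
    (h0 : ((0 : Lp ℝ 1 μ), (0 : Lp ℝ 1 μ)) ∈ opTrace A) (hu₀ : u₀ ∈ LOneInter μ)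
    (hω : 0 ≤ ω) (hu₀ω : 0 < ω → u₀ = 0) : u₀ = 0 := by
  rcases hω.eq_or_lt with rfl | hω
  · have h1 := hGN 0 0 h0
    have hb : qBracket q (0 - u₀) (0 : Lp ℝ 1 μ) = 0 := by simp [qBracket]
    rw [hb, zero_mul, add_zero, mul_zero, zero_mul, zero_sub, rNorm_neg] at h1
    refine eq_zero_of_rNorm_eq_zero hu₀ hr ?_
    by_contra h
    have := Real.rpow_pos_of_pos (lt_of_le_of_ne (rNorm_nonneg r u₀) (Ne.symm h)) σ
    linarith
  · exact hu₀ω hω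

lemma SatisfiesSobolevFamily.satisfiesGN {κ m p q₀ C q : ℝ} {u₀ : Lp ℝ 1 μ}
    (h : SatisfiesSobolevFamily (opTrace A) u₀ κ m p q₀ ω C) (hq : q₀ ≤ q) :
    SatisfiesGN (opTrace A) u₀ ((q - p + 1) * m + 1) (ENNReal.ofReal (κ * m * q)) (m * q) 0 ω
      (C * (q / p) ^ p / (q - p + 1)) := by
  intro u v huv
  rw [Real.rpow_zero, mul_one]
  exact h q hq u v huv

/-- Smoothing from `L^{κ m q₀}` to `L^∞`. -/
lemma exists_rNorm_top_le {κ m p q₀ C : ℝ} (hω : 0 ≤ ω)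
    (hres : HasCompleteResolvent (opAddSmulId A ω)) (hκ : 1 < κ) (hm : 0 < m) (hp : 1 ≤ p)
    (hpq : p ≤ q₀) (hκmq : 1 ≤ κ * m * q₀) (hD : 0 < (κ - 1) * q₀ + p - 1 - 1 / m) (hC : 0 < C)
    (h : SatisfiesSobolevFamily (opTrace A) 0 κ m p q₀ ω C) :
    ∃ K β : ℝ, 0 < K ∧ 0 ≤ β ∧ ∀ (u : Lp ℝ 1 μ) (x : ℝ → Lp ℝ 1 μ), u ∈ LOneInter μ →
      IsMildSolution A u x → ∀ s t, 0 ≤ s → s < t →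
        rNorm ∞ (x t) ≤ K * (t - s) ^ (-(1 / (m * ((κ - 1) * q₀ + p - 1 - 1 / m)))) *
          Real.exp (ω * β * (t - s)) *
          qNorm (κ * m * q₀) (x s) ^ ((κ - 1) * q₀ / ((κ - 1) * q₀ + p - 1 - 1 / m)) := by
  obtain ⟨Λ, G, hG, hΛ⟩ := exists_moser_bound hκ hm hp hpq hD hC
  have hκ1 : 0 < κ - 1 := by linarith
  set D := (κ - 1) * q₀ + p - 1 - 1 / m with hDdef
  -- The limiting exponent of the iteration; raising its bound to this power produces α*, γ* and the
  -- rate Ge.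
  set e := (κ - 1) / (m * D) with he
  have he0 : 0 < e := by positivity
  refine ⟨Real.exp (Λ * e), G * e, Real.exp_pos _, by positivity, ?_⟩
  intro u x hu hx s t hs hst
  have hδ : 0 < t - s := sub_pos.2 hst
  have hge : ∀ q, q₀ ≤ q → 1 ≤ κ * m * q := fun q hq =>
    hκmq.trans (mul_le_mul_of_nonneg_left hq (by positivity))
  obtain ⟨r, B, hr, hB, hle⟩ := hΛ ω (fun r τ => qNorm r (x τ)) s t hω
    (fun r τ => qNorm_nonneg _ _) hst
    (fun q hq s' hs' hst₁ => hx.qNorm_le hω hres hu (hs.trans hs') hst₁ (hge q hq))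
    (by
      intro q hq s' t' hs' hst'
      have hq0 : 0 < q := by linarith
      have hqp : 1 ≤ q - p + 1 := by linarith
      have h1 := hx.smoothing hω hres hu (hs.trans hs') hst' (q := (q - p + 1) * m + 1)
        (by have := mul_nonneg (zero_le_one.trans hqp) hm.le
            linarith)
        (one_le_ofReal (hge q hq)) (mul_pos hm hq0) le_rfl
        (by positivity) (h.satisfiesGN hq)
      rw [add_zero] at h1
      refine ENNReal.toReal_le_of_le_ofReal ?_ h1
      have := qNorm_nonneg ((q - p + 1) * m + 1) (x s')
      have := sub_pos.2 hst'
      positivity)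
  have hxt := hx.mem_LOneInter hω hres hu (hs.trans hst.le)
  refine (rNorm_top_le_of_tendsto hxt hr hB (Eventually.of_forall hle)).trans (le_of_eq ?_)
  have hN := qNorm_nonneg (κ * m * q₀) (x s)
  rw [Real.mul_rpow (by positivity) (by positivity), Real.mul_rpow (by positivity) (by positivity),
    ← Real.exp_mul, ← Real.rpow_mul hδ.le, ← Real.rpow_mul hN, add_mul, Real.exp_add]
  have e1 : -(1 / (κ - 1)) * e = -(1 / (m * D)) := by rw [he]; field_simp
  have e2 : m * q₀ * e = (κ - 1) * q₀ / D := by rw [he]; field_simp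
  have e3 : ω * G * (t - s) * e = ω * (G * e) * (t - s) := by ring
  rw [e1, e2, e3]
  ring

/-- Extrapolation of an `L^R`-`L^∞` smoothing estimate to an `L^s`-`L^∞` smoothing estimate. -/
lemma IsMildSolution.extrapolate {u : Lp ℝ 1 μ} {x : ℝ → Lp ℝ 1 μ} (hx : IsMildSolution A u x)
    (hω : 0 ≤ ω) (hres : HasCompleteResolvent (opAddSmulId A ω)) (hu : u ∈ LOneInter μ)
    {K a β g R s t : ℝ} (hK : 0 < K) (ha : 0 ≤ a) (hg : 0 ≤ g) (hs : 1 ≤ s) (hsR : s ≤ R)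
    (hβ : 0 ≤ β) (hθ : g * (1 - s / R) < 1) (ht : 0 < t)
    (h : ∀ s t, 0 ≤ s → s < t → rNorm ∞ (x t) ≤
      K * (t - s) ^ (-a) * Real.exp (ω * β * (t - s)) * qNorm R (x s) ^ g) :
    rNorm ∞ (x t) ≤ (K * 2 ^ (a + a / (1 - g * (1 - s / R)) * (g * (1 - s / R)))) ^
        (1 / (1 - g * (1 - s / R))) * t ^ (-(a / (1 - g * (1 - s / R)))) *
      Real.exp (ω * ((β / 2 + g * s / R) / (1 - g * (1 - s / R))) * t) *
      qNorm s u ^ (g * s / (R * (1 - g * (1 - s / R)))) := by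
  have hR : 0 < R := by linarith
  have hs0 : 0 < s := by linarith
  have hsR1 : s / R ≤ 1 := div_le_one_of_le₀ hsR hR.le
  set θ := g * (1 - s / R) with hθdef
  have hθ0 : 0 ≤ θ := mul_nonneg hg (by linarith)
  have hθ1 : 0 < 1 - θ := by linarith
  set n₀ := qNorm s u with hn₀
  have hn₀0 : 0 ≤ n₀ := qNorm_nonneg _ _
  -- The absorption needs a constant independent of τ, so the exponentials are bounded by their
  -- value at τ = t. The half in β/2 is the length τ/2 of the interval on which smoothing is used.
  set F := ω * (β / 2 + g * s / R) * t with hF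
  set D := K * 2 ^ a * Real.exp F * n₀ ^ (g * s / R) with hD
  have hD0 : 0 ≤ D := by positivity
  have hmain := le_of_le_mul_half_rpow (φ := fun τ => rNorm ∞ (x τ)) (t := t) (a := a) (D := D)
    (θ := θ) (M := Real.exp (ω * t) * rNorm ∞ u) ht ha hD0 hθ0 hθ (fun τ => rNorm_nonneg _ _) ?_ ?_
  · refine hmain.trans (le_of_eq ?_)
    have e0 : D * 2 ^ (a / (1 - θ) * θ) =
        K * 2 ^ (a + a / (1 - θ) * θ) * Real.exp F * n₀ ^ (g * s / R) := by
      rw [Real.rpow_add two_pos, hD]; ring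
    rw [e0, Real.mul_rpow (by positivity) (by positivity),
      Real.mul_rpow (by positivity) (by positivity), ← Real.exp_mul, ← Real.rpow_mul hn₀0]
    have e1 : F * (1 / (1 - θ)) = ω * ((β / 2 + g * s / R) / (1 - θ)) * t := by
      rw [hF]; ring
    have e2 : g * s / R * (1 / (1 - θ)) = g * s / (R * (1 - θ)) := by
      field_simp
    rw [e1, e2]
    ring
  · intro τ hτ0 hτt
    refine (hx.rNorm_top_le hω hres hu hτ0).trans
      (mul_le_mul_of_nonneg_right (Real.exp_le_exp.2 ?_) (rNorm_nonneg _ _))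
    exact mul_le_mul_of_nonneg_left hτt hω
  · intro τ hτ0 hτt
    have h2 : 0 < τ / 2 := by linarith
    have h1 := h (τ / 2) τ h2.le (by linarith)
    have e1 : τ - τ / 2 = τ / 2 := by ring
    rw [e1] at h1
    have hxm := hx.mem_LOneInter hω hres hu h2.le
    have h3 := qNorm_interpolate hxm hs hsR
    have h4 := hx.qNorm_le hω hres hu le_rfl h2 hs
    rw [hx.2.1, sub_zero] at h4
    have hφ := rNorm_nonneg ∞ (x (τ / 2))
    have h5 : qNorm R (x (τ / 2)) ^ g ≤ rNorm ∞ (x (τ / 2)) ^ θ *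
        (Real.exp (ω * (g * s / R) * (τ / 2)) * n₀ ^ (g * s / R)) := by
      have hsR0 : 0 ≤ s / R := by positivity
      have h6 : qNorm R (x (τ / 2)) ≤ rNorm ∞ (x (τ / 2)) ^ (1 - s / R) *
          (Real.exp (ω * (τ / 2)) * n₀) ^ (s / R) :=
        h3.trans (mul_le_mul_of_nonneg_left
          (Real.rpow_le_rpow (qNorm_nonneg _ _) h4 hsR0) (Real.rpow_nonneg hφ _))
      refine (Real.rpow_le_rpow (qNorm_nonneg _ _) h6 hg).trans (le_of_eq ?_)
      rw [Real.mul_rpow (by positivity) (by positivity), ← Real.rpow_mul hφ,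
        ← Real.rpow_mul (by positivity), Real.mul_rpow (by positivity) hn₀0, ← Real.exp_mul]
      have e2 : (1 - s / R) * g = θ := by rw [hθdef]; ring
      have e3 : s / R * g = g * s / R := by ring
      have e4 : ω * (τ / 2) * (s / R * g) = ω * (g * s / R) * (τ / 2) := by ring
      rw [e4, e2, e3]
    have h7 : Real.exp (ω * β * (τ / 2)) * Real.exp (ω * (g * s / R) * (τ / 2)) ≤ Real.exp F := by
      rw [← Real.exp_add]
      refine Real.exp_le_exp.2 ?_
      have h8 : 0 ≤ g * s / R := by positivity
      have h9 : ω * (β / 2) * τ ≤ ω * (β / 2) * t := by gcongr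
      have h10 : ω * (g * s / R) * (τ / 2) ≤ ω * (g * s / R) * t := by
        gcongr; linarith
      rw [hF]
      linarith
    have e5 : (τ / 2) ^ (-a) = 2 ^ a * τ ^ (-a) := by
      rw [Real.div_rpow hτ0.le (by norm_num), Real.rpow_neg (by norm_num : (0 : ℝ) ≤ 2)]
      field_simp
    calc rNorm ∞ (x τ) ≤ K * (τ / 2) ^ (-a) * Real.exp (ω * β * (τ / 2)) *
          qNorm R (x (τ / 2)) ^ g := h1
      _ ≤ K * (τ / 2) ^ (-a) * Real.exp (ω * β * (τ / 2)) * (rNorm ∞ (x (τ / 2)) ^ θ *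
        (Real.exp (ω * (g * s / R) * (τ / 2)) * n₀ ^ (g * s / R))) := by gcongr
      _ = K * 2 ^ a * (Real.exp (ω * β * (τ / 2)) * Real.exp (ω * (g * s / R) * (τ / 2))) *
          n₀ ^ (g * s / R) * τ ^ (-a) * rNorm ∞ (x (τ / 2)) ^ θ := by
        rw [e5]; ring
      _ ≤ K * 2 ^ a * Real.exp F * n₀ ^ (g * s / R) * τ ^ (-a) * rNorm ∞ (x (τ / 2)) ^ θ := by
        gcongr

end Main

/-- Regularisation estimates for semigroups generated by operators in `L¹` with complete
(or `c`-complete) resolvent. -/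
theorem mainTheorem3 {α : Type*} [MeasurableSpace α] (μ : Measure α) [SigmaFinite μ]
    (A : Set (Lp ℝ 1 μ × Lp ℝ 1 μ)) (ω : ℝ) (hω : 0 ≤ ω)
    (hA : IsMTAccretive (opAddSmulId A ω))
    (hres : HasCompleteResolvent (opAddSmulId A ω) ∨
      (HasCCompleteResolvent (opAddSmulId A ω) ∧ ω = 0))
    (hrange : LOneInter μ ⊆ opRange (opIdAddSmul 1 (opAddSmulId (opTrace A) ω)))
    (q : ℝ) (hq : 1 ≤ q) (r : ℝ≥0∞) (hr : 1 ≤ r) (σ ϱ C : ℝ) (hσ : 0 < σ) (hϱ : 0 ≤ ϱ) (hC : 0 < C)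
    (u₀ : Lp ℝ 1 μ) (hu₀ : (u₀, 0) ∈ opTrace A) (hu₀ω : 0 < ω → u₀ = 0)
    (hGN : SatisfiesGN (opTrace A) u₀ q r σ ϱ ω C)
    (T : ℝ → Lp ℝ 1 μ → Lp ℝ 1 μ) (hT : IsSemigroupGeneratedByNeg A T) :
    (∀ t : ℝ, 0 < t → ∀ u : Lp ℝ 1 μ, u ∈ closure (opDomain A) ∩ LOneInter μ →
      eLpNorm (T t u - u₀ : Lp ℝ 1 μ) r μ ≤
        ENNReal.ofReal ((C / q) ^ (1 / σ) * t ^ (-(1 / σ)) *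
          Real.exp (ω * ((q + ϱ) / σ + 1) * t) * qNorm q (u - u₀) ^ ((q + ϱ) / σ))) ∧
    (∀ κ m p q₀ C' : ℝ, 1 < κ → 0 < m → 1 ≤ p → p ≤ q₀ → 1 ≤ κ * m * q₀ →
      0 < (κ - 1) * q₀ + p - 1 - 1 / m → 0 < C' →
      SatisfiesSobolevFamily (opTrace A) u₀ κ m p q₀ ω C' →
      ∃ βstar : ℝ, 0 ≤ βstar ∧
        ∀ αstar γstar : ℝ,
          αstar = 1 / (m * ((κ - 1) * q₀ + p - 1 - 1 / m)) →
          γstar = (κ - 1) * q₀ / ((κ - 1) * q₀ + p - 1 - 1 / m) →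
          ∀ s : ℝ, 1 ≤ s → s ≤ κ * m * q₀ → γstar * (1 - s / (κ * m * q₀)) < 1 →
            ∀ α_s β_s γ_s : ℝ,
              α_s = αstar / (1 - γstar * (1 - s / (κ * m * q₀))) →
              β_s = (βstar / 2 + γstar * s / (κ * m * q₀)) /
                (1 - γstar * (1 - s / (κ * m * q₀))) →
              γ_s = γstar * s / (κ * m * q₀ * (1 - γstar * (1 - s / (κ * m * q₀)))) →
              ∃ K : ℝ, 0 < K ∧
                ∀ t : ℝ, 0 < t → ∀ u : Lp ℝ 1 μ, u ∈ closure (opDomain A) ∩ LOneInter μ →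
                  eLpNorm (T t u - u₀ : Lp ℝ 1 μ) ∞ μ ≤
                    ENNReal.ofReal (K * t ^ (-α_s) * Real.exp (ω * β_s * t) *
                      qNorm s (u - u₀) ^ γ_s)) := by
  have hres' : HasCompleteResolvent (opAddSmulId A ω) :=
    hres.elim id fun h => h.1.hasCompleteResolvent
  -- From here on u₀ = 0, in both alternatives for the resolvent.
  obtain rfl := hGN.eq_zero hr (zero_mem_opTrace hres' hrange) hu₀.2.1 hω hu₀ω
  simp only [sub_zero]
  refine ⟨?_, ?_⟩
  · intro t ht u hu
    have h1 := (hT u hu.1).smoothing hω hres' hu.2 le_rfl ht hq hr hσ hϱ hC hGN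
    have h0 : T 0 u = u := (hT u hu.1).2.1
    rwa [h0, sub_zero] at h1
  · intro κ m p q₀ C' hκ hm hp hpq hκmq hD hC' hS
    obtain ⟨K, β, hK, hβ, hbound⟩ :=
      exists_rNorm_top_le hω hres' hκ hm hp hpq hκmq hD hC' hS
    refine ⟨β, hβ, ?_⟩
    rintro a _ ha rfl s hs hsR hθ α_s β_s γ_s rfl rfl rfl
    have hq₀ : 0 < q₀ := by linarith
    have hκ1 : 0 < κ - 1 := by linarith
    have hg : 0 ≤ (κ - 1) * q₀ / ((κ - 1) * q₀ + p - 1 - 1 / m) := by positivity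
    have ha0 : 0 ≤ a := by rw [ha]; positivity
    set g := (κ - 1) * q₀ / ((κ - 1) * q₀ + p - 1 - 1 / m)
    refine ⟨(K * 2 ^ (a + a / (1 - g * (1 - s / (κ * m * q₀))) * (g * (1 - s / (κ * m * q₀))))) ^
      (1 / (1 - g * (1 - s / (κ * m * q₀)))), by positivity, fun t ht u hu => ?_⟩
    have hx := hT u hu.1
    rw [← ofReal_rNorm (hx.mem_LOneInter hω hres' hu.2 ht.le) le_top]
    refine ENNReal.ofReal_le_ofReal
      (hx.extrapolate hω hres' hu.2 hK ha0 hg hs hsR hβ hθ ht fun s t hs hst => ?_)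
    rw [ha]
    exact hbound u _ hu.2 hx s t hs hst
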